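/- \textbf{Setting.} Let $G=(V,E)$ be a finite simple graph with $n=|V|$ vertices and maximum degree $\Delta$, and let $q\ge 2$. A spin system on $G$ consists of external fields $b_v\in\mathbb{R}_{\ge 0}^q$ ($v\in V$) and symmetric interaction matrices $A_e\in\mathbb{R}_{\ge 0}^{q\times q}$ ($e\in E$); its Gibbs distribution $\mu$ on $[q]^V$ is $\mu(\sigma)\propto\prod_{u\in V}b_u(\sigma_u)\prod_{e=\{v,w\}\in E}A_e(\sigma_v,\sigma_w)$. For $\Lambda\subseteq V$ and a pinning $\tau\in[q]^{V\setminus\Lambda}$, $\mu^\tau$ is the distribution on $[q]^V$ with $$\mu^\tau(\sigma)\propto \mathbf 1[\sigma_{V\setminus\Lambda}=\tau]\prod_{u\in\Lambda}b_u(\sigma_u)\prod_{e=\{v,w\}\in E,\ e\cap\Lambda\ne\emptyset}A_e(\sigma_v,\sigma_w),$$ and it is assumed throughout that for every pinning these weights do not all vanish. Write $\Omega(\nu)$ for the support of a distribution $\nu$. The Glauber dynamics of a distribution $\nu$ on $[q]^V$ picks, in each step, a uniformly random $v\in V$ and resamples the spin of $v$ from $\nu$ conditioned on all the other spins. For $X\in\Omega(\nu)$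 let $T_{\rm mix}(\nu,\epsilon\mid X)$ be the least $t>0$ such that the law of the dynamics after $t$ steps from $X$ is within total variation distance $\epsilon$ of $\nu$ ($\infty$ if there is none), and $T_{\rm mix}(\nu,\epsilon)=\max_{X\in\Omega(\nu)}T_{\rm mix}(\nu,\epsilon\mid X)$. For $\eta\in[0,1]$ let $$T_{\rm mix}^{(\eta)}(\mu)=\max\Bigl\{T_{\rm mix}\bigl(\mu^\tau,\tfrac1{4e}\bigr)\ :\ \Lambda\subseteq V,\ G[\Lambda]\text{ has maximum degree}\le\eta\Delta,\ \tau\in[q]^{V\setminus\Lambda}\Bigr\}.$$ For $\rho:V\to\mathbb{N}_{>0}$ let $H_\rho(X,Y)=\sum_{v:X_v\ne Y_v}\rho(v)$. The system is \emph{$M$-coupling independent with Hamming weight $\rho$} if for all $S\subseteq V$ and all $\sigma_1,\sigma_2\in[q]^S$ that disagree exactly at one vertex $v_0\in S$ there is a coupling $(X,Y)$ of $\mu^{\sigma_1}$ and $\mu^{\sigma_2}$ with $\mathbb{E}[H_\rho(X,Y)]\le M\rho(v_0)$. Fix a total order $\le_v$ on $[q]$ for every $v\in V$, and let $X\le Y$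 iff $X_v\le_v Y_v$ for all $v$. The system is \emph{monotone} if for every $v\in V$ and all $X\le Y$ in $[q]^V$ there is a coupling of $\mu^{X_{V\setminus v}}$ and $\mu^{Y_{V\setminus v}}$ supported on ordered pairs $X'\le Y'$. Let $X^+$ be the maximum configuration, that is, the greatest element of $\Omega(\mu)$ (it is the greatest element of $[q]^V$ whenever that one is in $\Omega(\mu)$). \textbf{Theorem.} There is a universal constant $C_0>0$, and for every $K$ a constant $C=C(K)>0$, such that the following holds. Let $M\ge1$, $0<\eta\le\frac1{2\lceil M\rceil}$ and $d\ge0$. Let $\mu$ be the Gibbs distribution of a monotone spin system on a graph $G$ with maximum degree $\Delta\ge C_0\frac{M^2}{\eta^2}\log\frac M\eta$ that is $M$-coupling independent with a Hamming weight $\rho$ such that $\max_v\rho(v)/\min_v\rho(v)\le Kn^d$. Then for every $\epsilon\in(0,1)$, $$T_{\rm mix}(\mu,\epsilon\mid X^+)\ \le\ \Bigl(\log\frac n\epsilon\Bigr)^{C(M/\eta+d)}\cdot T_{\rm mix}^{(\eta)}(\mu).$$ -/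

import Mathlib

open scoped NNReal ENNReal

noncomputable section

namespace MixCom

/-! ### Finite distributions on `[q]^V`, couplings, total variation

Distributions on the finite set `V → Fin q` are given by their probability mass functions. -/

section Distributions

variable {Ω : Type*} [Fintype Ω]

/-- `π` is the mass function of a coupling of `ν₁` and `ν₂`. -/
structure IsCoupling (π : Ω → Ω → ℝ) (ν₁ ν₂ : Ω → ℝ) : Prop where
  nonneg : ∀ x y, 0 ≤ π x y
  fst : ∀ x, ∑ y, π x y = ν₁ x
  snd : ∀ y, ∑ x, π x y = ν₂ y

/-- Total variation distance. -/
def tvDist (ν₁ ν₂ : Ω → ℝ) : ℝ := (∑ x, |ν₁ x - ν₂ x|) / 2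

end Distributions

section Glauber

variable {V : Type*} [Fintype V] [DecidableEq V] {q : ℕ}

/-- The update at `v`: resample the spin of `v` from the conditional distribution of `ν` given the
spins of all other vertices. This is a stochastic kernel on the support of `ν`, which it preserves;
the dynamics is only ever started from a state in the support. -/
def siteUpdate (ν : (V → Fin q) → ℝ) (v : V) (X Y : V → Fin q) : ℝ :=
  if ∀ u, u ≠ v → Y u = X u then ν Y / ∑ c, ν (Function.update X v c) else 0

/-- Transition matrix of the Glauber dynamics of `ν`: a uniformly random vertex of `V` is updated. -/
def glauber (ν : (V → Fin q) → ℝ) : Matrix (V → Fin q) (V → Fin q) ℝ :=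
  fun X Y => (∑ v, siteUpdate ν v X Y) / (Fintype.card V : ℝ)

/-- `T_mix(ν, ε | X)`: the least `t > 0` for which the law of the Glauber dynamics after `t` steps
from `X` is within total variation distance `ε` of `ν`; it is `⊤` if there is no such `t`. -/
def mixTimeFrom (ν : (V → Fin q) → ℝ) (ε : ℝ) (X : V → Fin q) : ℕ∞ :=
  ⨅ (t : ℕ) (_ : 0 < t ∧ tvDist ((glauber ν ^ t) X) ν ≤ ε), (t : ℕ∞)

/-- `T_mix(ν, ε)`: the maximum of `T_mix(ν, ε | X)` over all `X` in the support of `ν`. -/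
def mixTime (ν : (V → Fin q) → ℝ) (ε : ℝ) : ℕ∞ :=
  ⨆ (X : V → Fin q) (_ : 0 < ν X), mixTimeFrom ν ε X

end Glauber

/-! ### Spin systems -/

/-- A spin system on `G` with spins `Fin q`: an external field at every vertex and, at every edge,
a symmetric nonnegative interaction matrix, that is, a function on unordered pairs of spins.
(The values of `interaction` at non-edges play no role.) -/
structure SpinSystem {V : Type*} (G : SimpleGraph V) (q : ℕ) where
  field : V → Fin q → ℝ≥0
  interaction : Sym2 V → Sym2 (Fin q) → ℝ≥0

namespace SpinSystem

variable {V : Type*} [Fintype V] [DecidableEq V] {G : SimpleGraph V} [DecidableRel G.Adj] {q : ℕ}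

/-- `w(σ) = ∏_u b_u(σ_u) ∏_{e = {v,w}} A_e(σ_v, σ_w)`. -/
def weight (S : SpinSystem G q) (σ : V → Fin q) : ℝ :=
  (∏ u, (S.field u (σ u) : ℝ)) * ∏ e ∈ G.edgeFinset, (S.interaction e (e.map σ) : ℝ)

/-- The Gibbs distribution `μ`. -/
def gibbs (S : SpinSystem G q) (σ : V → Fin q) : ℝ :=
  S.weight σ / ∑ σ', S.weight σ'

/-- The weight `w^τ` for the free set `Λ` and the pinning `τ` on `V ∖ Λ`: only fields at vertices
of `Λ` and edges meeting `Λ` are kept. A pinning on `V ∖ Λ` is represented by any full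
configuration `τ` extending it; only the values of `τ` off `Λ` enter. -/
def pinnedWeight (S : SpinSystem G q) (Λ : Finset V) (τ σ : V → Fin q) : ℝ :=
  if ∀ v, v ∉ Λ → σ v = τ v then
    (∏ u ∈ Λ, (S.field u (σ u) : ℝ)) *
      ∏ e ∈ G.edgeFinset with ∃ v ∈ Λ, v ∈ e, (S.interaction e (e.map σ) : ℝ)
  else 0

/-- The distribution `μ^τ` on `[q]^V`, for the pinning `τ` on `V ∖ Λ`. -/
def pinnedGibbs (S : SpinSystem G q) (Λ : Finset V) (τ σ : V → Fin q) : ℝ :=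
  S.pinnedWeight Λ τ σ / ∑ σ', S.pinnedWeight Λ τ σ'

/-- The standing assumption on spin systems: `∑_σ w^τ(σ) > 0` for every pinning `τ`, so that all
the distributions `μ^τ` (and `μ`, when nothing is pinned) are well defined. -/
def WellDefined (S : SpinSystem G q) : Prop :=
  ∀ (Λ : Finset V) (τ : V → Fin q), 0 < ∑ σ, S.pinnedWeight Λ τ σ

/-- Weighted Hamming distance `H_ρ`. -/
def hammingDist (ρ : V → ℕ+) (σ τ : V → Fin q) : ℝ :=
  ∑ v with σ v ≠ τ v, ((ρ v : ℕ) : ℝ)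

/-- `μ` is `C`-coupling independent with Hamming weight function `ρ`: any two pinnings on a set
`V ∖ Λ` that disagree exactly at one vertex `v₀ ∈ V ∖ Λ` admit a coupling `(X, Y)` of `μ^{σ₁}`
and `μ^{σ₂}` with `E[H_ρ(X, Y)] / ρ(v₀) ≤ C`. -/
def CouplingIndependent (S : SpinSystem G q) (C : ℝ) (ρ : V → ℕ+) : Prop :=
  ∀ (Λ : Finset V) (v₀ : V) (σ₁ σ₂ : V → Fin q), v₀ ∉ Λ → σ₁ v₀ ≠ σ₂ v₀ →
    (∀ v, v ∉ Λ → v ≠ v₀ → σ₁ v = σ₂ v) →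
    ∃ π : (V → Fin q) → (V → Fin q) → ℝ,
      IsCoupling π (S.pinnedGibbs Λ σ₁) (S.pinnedGibbs Λ σ₂) ∧
      (∑ X, ∑ Y, π X Y * hammingDist ρ X Y) / ((ρ v₀ : ℕ) : ℝ) ≤ C

/-- The partial order on `[q]^V` given by a total order `≤_v` on the spins for every vertex. -/
def ConfigLE (ord : V → LinearOrder (Fin q)) (X Y : V → Fin q) : Prop :=
  ∀ v, (ord v).le (X v) (Y v)

/-- Stochastic domination `ν₁ ⪯ ν₂`: some coupling is supported on pairs `X ≤ Y`. -/
def StochDominated (ord : V → LinearOrder (Fin q)) (ν₁ ν₂ : (V → Fin q) → ℝ) : Prop :=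
  ∃ π, IsCoupling π ν₁ ν₂ ∧ ∀ X Y, π X Y ≠ 0 → ConfigLE ord X Y

/-- Monotone spin system: each kernel `P_v(X, ·) = μ^{X_{V ∖ v}}` preserves the order. -/
def IsMonotone (S : SpinSystem G q) (ord : V → LinearOrder (Fin q)) : Prop :=
  ∀ (v : V) (X Y : V → Fin q), ConfigLE ord X Y →
    StochDominated ord (S.pinnedGibbs {v} X) (S.pinnedGibbs {v} Y)

/-- `X` is the maximum configuration of the support `Ω(μ)`. -/
def IsMaxConfig (S : SpinSystem G q) (ord : V → LinearOrder (Fin q)) (X : V → Fin q) : Prop :=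
  0 < S.gibbs X ∧ ∀ Y, 0 < S.gibbs Y → ConfigLE ord Y X

/-- `T_mix^{(η)}(μ)`: the maximum of `T_mix(μ^τ, 1/(4e))` over all `Λ ⊆ V` such that `G[Λ]` has
maximum degree at most `η Δ`, and all pinnings `τ` on `V ∖ Λ`. -/
def pinnedMixTime (S : SpinSystem G q) (η : ℝ) : ℕ∞ :=
  ⨆ (Λ : Finset V)
    (_ : ((G.induce (Λ : Set V)).maxDegree : ℝ) ≤ η * (G.maxDegree : ℝ))
    (τ : V → Fin q), mixTime (S.pinnedGibbs Λ τ) (1 / (4 * Real.exp 1))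

end SpinSystem

end MixCom

end

open scoped NNReal ENNReal

noncomputable section

namespace MixCom

namespace SpinSystem

variable {V : Type*} [Fintype V] [DecidableEq V] {G : SimpleGraph V} [DecidableRel G.Adj] {q : ℕ}

/-! ### Block kernels -/

/-! Two ingredients are combined: censoring, which uses monotonicity, and a recursive block
dynamics, which uses coupling independence.

Censoring: for increasing `f`, `g`, a single-site update `P` satisfies `⟨f, P g⟩ ≤ ⟨f, g⟩` in
`L²(μ)`, by Chebyshev's correlation inequality applied conditionally (`gibbsInner_blockKernel_le`).
Suppressing updates therefore only increases `⟨f, Q g⟩`, and this survives products and averages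
(`Censored.mul`, `Censored.average`). Started from the maximum configuration, the law of the
dynamics has an increasing density with respect to `μ`, so its distance to `μ` is attained on an
increasing event. There any censored version has at least as much mass, hence is at least as far
from `μ` (`tvDist_glauber_pow_le`). It is enough to exhibit one censored version that is close to
`μ`.

Block dynamics: resampling a random block `B ⊆ Λ` that misses each vertex of `Λ` with probability at
most `1 / (2 M)` halves weighted Lipschitz constants, by path coupling (`block_dynamics_lipschitz`).
Such blocks can be chosen with all degrees smaller by a factor `1 - 1 / (2 (k + 1))`, where `k + 1`
is of order `M`: drop each vertex with probability `1 / (k + 1)`, then drop those that keep too many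
neighbours (`exists_sparse_blocks`). The Chernoff bound is needed at one vertex at a time, so the
degree condition does not involve `n`.

Each block update is in turn simulated by `t` rounds on still sparser blocks. After `l` levels, with
`l` of order `M log (1 / η)`, the degrees are at most `η Δ`, and the Glauber dynamics inside the
block, a censored dynamics, mixes at the rate measured by `pinnedMixTime`. This uses `t ^ (l + 1)`
times that mixing time (`exists_censored_near`), and a `t` polynomial in `l` and linear in `log (n /
ε)` makes the accumulated error small. -/

/-- The heat-bath update of the block `Λ`. -/
def blockKernel (S : SpinSystem G q) (Λ : Finset V) : Matrix (V → Fin q) (V → Fin q) ℝ :=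
  fun X Y => S.pinnedGibbs Λ X Y

/-- The Glauber dynamics on `V` in which all updates outside `Λ` are suppressed. -/
def glauberOn (S : SpinSystem G q) (Λ : Finset V) : Matrix (V → Fin q) (V → Fin q) ℝ :=
  (Fintype.card V : ℝ)⁻¹ • ∑ v, if v ∈ Λ then S.blockKernel {v} else 1

theorem pinnedWeight_nonneg (S : SpinSystem G q) (Λ : Finset V) (τ σ : V → Fin q) :
    0 ≤ S.pinnedWeight Λ τ σ := by
  unfold pinnedWeight
  split_ifs
  · positivity
  · exact le_rfl

theorem pinnedWeight_congr (S : SpinSystem G q) {Λ : Finset V} {τ τ' : V → Fin q}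
    (h : ∀ v, v ∉ Λ → τ v = τ' v) : S.pinnedWeight Λ τ = S.pinnedWeight Λ τ' := by
  funext σ
  unfold pinnedWeight
  have : (∀ v, v ∉ Λ → σ v = τ v) ↔ (∀ v, v ∉ Λ → σ v = τ' v) :=
    forall₂_congr fun v hv => by rw [h v hv]
  simp only [this]

theorem pinnedGibbs_congr (S : SpinSystem G q) {Λ : Finset V} {τ τ' : V → Fin q}
    (h : ∀ v, v ∉ Λ → τ v = τ' v) : S.pinnedGibbs Λ τ = S.pinnedGibbs Λ τ' := by
  funext σ
  simp only [pinnedGibbs, S.pinnedWeight_congr h]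

theorem pinnedWeight_eq_zero (S : SpinSystem G q) {Λ : Finset V} {τ σ : V → Fin q}
    (h : ¬ ∀ v, v ∉ Λ → σ v = τ v) : S.pinnedWeight Λ τ σ = 0 := if_neg h

theorem pinnedGibbs_nonneg (S : SpinSystem G q) (Λ : Finset V) (τ σ : V → Fin q) :
    0 ≤ S.pinnedGibbs Λ τ σ :=
  div_nonneg (S.pinnedWeight_nonneg _ _ _)
    (Finset.sum_nonneg fun _ _ => S.pinnedWeight_nonneg _ _ _)

theorem pinnedGibbs_eq_zero (S : SpinSystem G q) {Λ : Finset V} {τ σ : V → Fin q}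
    (h : ¬ ∀ v, v ∉ Λ → σ v = τ v) : S.pinnedGibbs Λ τ σ = 0 := by
  rw [pinnedGibbs, S.pinnedWeight_eq_zero h, zero_div]

theorem agree_of_blockKernel_ne_zero (S : SpinSystem G q) {Λ : Finset V} {X Y : V → Fin q}
    (h : S.blockKernel Λ X Y ≠ 0) : ∀ v, v ∉ Λ → Y v = X v := by
  by_contra hc
  exact h (S.pinnedGibbs_eq_zero hc)

theorem sum_pinnedGibbs {S : SpinSystem G q} (hS : S.WellDefined) (Λ : Finset V)
    (τ : V → Fin q) : ∑ σ, S.pinnedGibbs Λ τ σ = 1 := by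
  simp only [pinnedGibbs, ← Finset.sum_div]
  exact div_self (hS Λ τ).ne'

theorem pinnedWeight_univ (S : SpinSystem G q) (τ σ : V → Fin q) :
    S.pinnedWeight Finset.univ τ σ = S.weight σ := by
  have : (G.edgeFinset.filter fun e => ∃ v ∈ (Finset.univ : Finset V), v ∈ e) = G.edgeFinset := by
    refine Finset.filter_true_of_mem fun e _ => ?_
    induction e with
    | _ a b => exact ⟨a, Finset.mem_univ _, by simp⟩
  rw [pinnedWeight, this, if_pos fun v hv => absurd (Finset.mem_univ v) hv, weight]

theorem pinnedGibbs_univ (S : SpinSystem G q) (τ : V → Fin q) :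
    S.pinnedGibbs Finset.univ τ = S.gibbs := by
  funext σ
  simp [pinnedGibbs, gibbs, pinnedWeight_univ]

/-- For `Λ' ⊆ Λ`, the weight `w^τ` on `Λ` is the weight on `Λ'` up to a factor that does not
depend on the spins in `Λ'`. -/
theorem exists_pinnedWeight_eq_mul (S : SpinSystem G q) {Λ' Λ : Finset V} (hΛ : Λ' ⊆ Λ)
    (τ : V → Fin q) :
    ∃ R : (V → Fin q) → ℝ, (∀ X Y, (∀ v, v ∉ Λ' → X v = Y v) → R X = R Y) ∧
      ∀ Y, S.pinnedWeight Λ τ Y = R Y * S.pinnedWeight Λ' Y Y := by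
  refine ⟨fun Y => if ∀ v, v ∉ Λ → Y v = τ v then
    (∏ u ∈ Λ \ Λ', (S.field u (Y u) : ℝ)) *
      ∏ e ∈ (G.edgeFinset.filter fun e => ∃ v ∈ Λ, v ∈ e).filter fun e => ¬ ∃ v ∈ Λ', v ∈ e,
        (S.interaction e (e.map Y) : ℝ) else 0, ?_, ?_⟩
  · intro X Y h
    have h1 : (∀ v, v ∉ Λ → X v = τ v) ↔ (∀ v, v ∉ Λ → Y v = τ v) :=
      forall₂_congr fun v hv => by rw [h v fun h' => hv (hΛ h')]
    simp only [h1]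
    split_ifs
    · congr 1
      · refine Finset.prod_congr rfl fun u hu => ?_
        rw [h u (Finset.mem_sdiff.1 hu).2]
      · refine Finset.prod_congr rfl fun e he => ?_
        have h2 := (Finset.mem_filter.1 he).2
        push Not at h2
        have : e.map X = e.map Y :=
          Sym2.map_congr fun v hv => h v fun hv' => h2 v hv' hv
        rw [this]
    · rfl
  · intro Y
    simp only [pinnedWeight, implies_true, if_true, ite_mul, zero_mul]
    refine if_congr Iff.rfl ?_ rfl
    rw [← Finset.prod_sdiff hΛ, ← Finset.prod_filter_mul_prod_filter_not
      (G.edgeFinset.filter fun e => ∃ v ∈ Λ, v ∈ e) (fun e => ∃ v ∈ Λ', v ∈ e)]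
    have : (G.edgeFinset.filter fun e => ∃ v ∈ Λ, v ∈ e).filter (fun e => ∃ v ∈ Λ', v ∈ e)
        = G.edgeFinset.filter fun e => ∃ v ∈ Λ', v ∈ e := by
      rw [Finset.filter_filter]
      refine Finset.filter_congr fun e _ => ⟨fun h => h.2, fun h => ⟨?_, h⟩⟩
      obtain ⟨v, hv, he⟩ := h
      exact ⟨v, hΛ hv, he⟩
    rw [this]
    ring

/-- Detailed balance for block updates. -/
theorem detailed_balance (S : SpinSystem G q) {Λ' Λ : Finset V} (hΛ : Λ' ⊆ Λ)
    (τ X Y : V → Fin q) :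
    S.pinnedGibbs Λ τ X * S.blockKernel Λ' X Y = S.pinnedGibbs Λ τ Y * S.blockKernel Λ' Y X := by
  by_cases h : ∀ v, v ∉ Λ' → X v = Y v
  · obtain ⟨R, hR, hw⟩ := S.exists_pinnedWeight_eq_mul hΛ τ
    have e := S.pinnedWeight_congr h
    simp only [blockKernel, pinnedGibbs, hw, hR X Y h, e]
    ring
  · have h' : ¬ ∀ v, v ∉ Λ' → Y v = X v := fun h' => h fun v hv => (h' v hv).symm
    simp only [blockKernel, S.pinnedGibbs_eq_zero h, S.pinnedGibbs_eq_zero h', mul_zero]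

/-- Stationarity of the conditional law: detailed balance turns the sum over the intermediate state
into a row sum of the smaller kernel. -/
theorem blockKernel_mul_of_subset {S : SpinSystem G q} (hS : S.WellDefined) {Λ' Λ : Finset V}
    (hΛ : Λ' ⊆ Λ) : S.blockKernel Λ * S.blockKernel Λ' = S.blockKernel Λ := by
  ext X Z
  rw [Matrix.mul_apply]
  have : ∀ Y, S.blockKernel Λ X Y * S.blockKernel Λ' Y Z
      = S.pinnedGibbs Λ X Z * S.pinnedGibbs Λ' Z Y := fun Y => S.detailed_balance hΛ X Y Z
  rw [Finset.sum_congr rfl fun Y _ => this Y, ← Finset.mul_sum, sum_pinnedGibbs hS, mul_one]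
  rfl

theorem blockKernel_mul_glauberOn [Nonempty V] {S : SpinSystem G q} (hS : S.WellDefined)
    (Λ : Finset V) : S.blockKernel Λ * S.glauberOn Λ = S.blockKernel Λ := by
  have : ∀ v, S.blockKernel Λ * (if v ∈ Λ then S.blockKernel {v} else 1) = S.blockKernel Λ := by
    intro v
    split_ifs with h
    · exact blockKernel_mul_of_subset hS (Finset.singleton_subset_iff.2 h)
    · exact mul_one _
  rw [glauberOn, Matrix.mul_smul, Finset.mul_sum]
  simp only [this, Finset.sum_const, Finset.card_univ, ← Nat.cast_smul_eq_nsmul ℝ, smul_smul]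
  rw [inv_mul_cancel₀ (by exact_mod_cast Fintype.card_ne_zero), one_smul]

/-! ### Identification of the Glauber dynamics of the pinned distributions -/

theorem sum_eq_sum_update {X : V → Fin q} {v : V} {F : (V → Fin q) → ℝ}
    (hF : ∀ Y, (¬ ∀ u, u ∉ ({v} : Finset V) → Y u = X u) → F Y = 0) :
    ∑ Y, F Y = ∑ c, F (Function.update X v c) := by
  have hinj : Function.Injective fun c => Function.update X v c := Function.update_injective X v
  rw [← Finset.sum_image (s := Finset.univ) (g := fun c => Function.update X v c) (f := F)
    (fun a _ b _ h => hinj h)]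
  symm
  refine Finset.sum_subset (Finset.subset_univ _) fun Y _ hY => hF Y fun h => hY ?_
  refine Finset.mem_image.2 ⟨Y v, Finset.mem_univ _, ?_⟩
  funext u
  by_cases hu : u = v
  · subst hu; simp
  · simp [hu, h u (by simpa using hu)]

/-- A pinned spin cannot change, and at a free vertex the part of the weight not involving it
cancels in the quotient. Off the support the quotient could be `0 / 0`, hence the positivity
hypothesis. Thus the Glauber dynamics of a pinned distribution is a censored version of the full
one. -/
theorem siteUpdate_pinnedGibbs (S : SpinSystem G q) {Λ : Finset V}
    {τ X : V → Fin q} (hX : 0 < S.pinnedGibbs Λ τ X) (v : V) (Y : V → Fin q) :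
    siteUpdate (S.pinnedGibbs Λ τ) v X Y = (if v ∈ Λ then S.blockKernel {v} else 1) X Y := by
  have hXτ : ∀ v, v ∉ Λ → X v = τ v := by
    by_contra hc
    exact hX.ne' (S.pinnedGibbs_eq_zero hc)
  have hmem : (∀ u, u ≠ v → Y u = X u) ↔ ∀ u, u ∉ ({v} : Finset V) → Y u = X u := by simp
  unfold siteUpdate
  split_ifs with h hv hv
  · obtain ⟨R, hR, hw⟩ := S.exists_pinnedWeight_eq_mul (Finset.singleton_subset_iff.2 hv) τ
    set Z := ∑ σ, S.pinnedWeight Λ τ σ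
    have key : ∀ Y, (∀ u, u ∉ ({v} : Finset V) → Y u = X u) →
        S.pinnedGibbs Λ τ Y = R X / Z * S.pinnedWeight {v} X Y := by
      intro Y hY
      rw [pinnedGibbs, hw, hR Y X hY, S.pinnedWeight_congr hY]
      ring
    have hRX : R X / Z ≠ 0 := by
      intro h0
      rw [key X fun _ _ => rfl, h0, zero_mul] at hX
      exact hX.ne rfl
    have hs : ∑ c, S.pinnedGibbs Λ τ (Function.update X v c)
        = R X / Z * ∑ σ, S.pinnedWeight {v} X σ := by
      rw [sum_eq_sum_update (F := S.pinnedWeight {v} X) (X := X) (v := v)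
        fun Y hY => S.pinnedWeight_eq_zero hY, Finset.mul_sum]
      refine Finset.sum_congr rfl fun c _ => key _ fun u hu => ?_
      simp only [Finset.mem_singleton] at hu
      simp [hu]
    rw [hs, key Y (hmem.1 h), mul_div_mul_left _ _ hRX]
    rfl
  · have hc : ∀ c, S.pinnedGibbs Λ τ (Function.update X v c)
        = if c = X v then S.pinnedGibbs Λ τ X else 0 := by
      intro c
      split_ifs with hc
      · rw [hc, Function.update_eq_self]
      · refine S.pinnedGibbs_eq_zero fun h' => hc ?_
        have := h' v hv
        rw [Function.update_self] at this
        rw [this, hXτ v hv]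
    simp only [hc, Finset.sum_ite_eq', Finset.mem_univ, if_true]
    have hY : Y = Function.update X v (Y v) := by
      funext u
      by_cases hu : u = v
      · subst hu; simp
      · simp [hu, h u hu]
    by_cases hXY : X = Y
    · subst hXY
      rw [div_self hX.ne', Matrix.one_apply_eq]
    · rw [Matrix.one_apply_ne hXY, hY, hc, if_neg, zero_div]
      intro h'
      rw [h', Function.update_eq_self] at hY
      exact hXY hY.symm
  · symm
    exact S.pinnedGibbs_eq_zero fun h' => h (hmem.2 h')
  · symm
    refine Matrix.one_apply_ne fun h' => h fun u _ => by rw [h']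

theorem glauber_pinnedGibbs_apply (S : SpinSystem G q) {Λ : Finset V}
    {τ X : V → Fin q} (hX : 0 < S.pinnedGibbs Λ τ X) (Y : V → Fin q) :
    glauber (S.pinnedGibbs Λ τ) X Y = S.glauberOn Λ X Y := by
  simp only [glauber, S.siteUpdate_pinnedGibbs hX, glauberOn, Matrix.smul_apply,
    Matrix.sum_apply, smul_eq_mul]
  rw [div_eq_inv_mul]

/-- By reversibility, a move of positive probability cannot leave the support. -/
theorem pinnedGibbs_pos_of_siteKernel (S : SpinSystem G q) {Λ Λ' : Finset V} (hΛ : Λ' ⊆ Λ)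
    {τ X Y : V → Fin q} (hX : 0 < S.pinnedGibbs Λ τ X) (h : S.blockKernel Λ' X Y ≠ 0) :
    0 < S.pinnedGibbs Λ τ Y := by
  refine (S.pinnedGibbs_nonneg Λ τ Y).lt_of_ne' fun h0 => ?_
  have := S.detailed_balance hΛ τ X Y
  rw [h0, zero_mul] at this
  exact (mul_ne_zero hX.ne' h) this

theorem pinnedGibbs_pos_of_glauberOn (S : SpinSystem G q) {Λ Λ' : Finset V} (hΛ : Λ' ⊆ Λ)
    {τ X Y : V → Fin q} (hX : 0 < S.pinnedGibbs Λ τ X) (h : S.glauberOn Λ' X Y ≠ 0) :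
    0 < S.pinnedGibbs Λ τ Y := by
  simp only [glauberOn, Matrix.smul_apply, Matrix.sum_apply, smul_eq_mul] at h
  obtain ⟨v, -, hv⟩ := Finset.exists_ne_zero_of_sum_ne_zero (right_ne_zero_of_mul h)
  split_ifs at hv with hm
  · exact S.pinnedGibbs_pos_of_siteKernel
      (Finset.singleton_subset_iff.2 (hΛ hm)) hX hv
  · by_cases hXY : X = Y
    · exact hXY ▸ hX
    · exact absurd (Matrix.one_apply_ne hXY) hv

theorem glauber_pow_pinnedGibbs_apply (S : SpinSystem G q) {Λ : Finset V} {τ : V → Fin q}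
    (t : ℕ) {X : V → Fin q} (hX : 0 < S.pinnedGibbs Λ τ X) (Y : V → Fin q) :
    (glauber (S.pinnedGibbs Λ τ) ^ t) X Y = (S.glauberOn Λ ^ t) X Y := by
  induction t generalizing X with
  | zero => simp
  | succ t ih =>
    rw [pow_succ', pow_succ', Matrix.mul_apply, Matrix.mul_apply]
    refine Finset.sum_congr rfl fun Z _ => ?_
    rw [S.glauber_pinnedGibbs_apply hX]
    by_cases h : S.glauberOn Λ X Z = 0
    · rw [h, zero_mul, zero_mul]
    · rw [ih (S.pinnedGibbs_pos_of_glauberOn subset_rfl hX h)]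

/-! ### Stochastic kernels -/

theorem blockKernel_mem_rowStochastic {S : SpinSystem G q} (hS : S.WellDefined) (Λ : Finset V) :
    S.blockKernel Λ ∈ Matrix.rowStochastic ℝ (V → Fin q) :=
  Matrix.mem_rowStochastic_iff_sum.2 ⟨fun X Y => S.pinnedGibbs_nonneg Λ X Y,
    fun X => sum_pinnedGibbs hS Λ X⟩

theorem average_mem_rowStochastic {Ω ι : Type*} [Fintype Ω] [DecidableEq Ω] [Fintype ι]
    [Nonempty ι] {Q : ι → Matrix Ω Ω ℝ} (hQ : ∀ i, Q i ∈ Matrix.rowStochastic ℝ Ω) :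
    (Fintype.card ι : ℝ)⁻¹ • ∑ i, Q i ∈ Matrix.rowStochastic ℝ Ω := by
  refine Matrix.mem_rowStochastic_iff_sum.2 ⟨fun X Y => ?_, fun X => ?_⟩
  · rw [Matrix.smul_apply, Matrix.sum_apply]
    exact mul_nonneg (by positivity)
      (Finset.sum_nonneg fun i _ => Matrix.nonneg_of_mem_rowStochastic (hQ i))
  · simp only [Matrix.smul_apply, Matrix.sum_apply, smul_eq_mul, ← Finset.mul_sum]
    rw [Finset.sum_comm]
    simp only [fun i => Matrix.sum_row_of_mem_rowStochastic (hQ i) X, Finset.sum_const,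
      Finset.card_univ, nsmul_eq_mul, mul_one]
    exact inv_mul_cancel₀ (by exact_mod_cast Fintype.card_ne_zero)

theorem average_mulVec {Ω ι : Type*} [Fintype Ω] [Fintype ι] (Q : ι → Matrix Ω Ω ℝ) (f : Ω → ℝ)
    (X : Ω) : (((Fintype.card ι : ℝ)⁻¹ • ∑ i, Q i).mulVec f) X
      = (Fintype.card ι : ℝ)⁻¹ * ∑ i, ((Q i).mulVec f) X := by
  rw [Matrix.smul_mulVec, Matrix.sum_mulVec, Pi.smul_apply, Finset.sum_apply, smul_eq_mul]

theorem siteKernel_mem_rowStochastic {S : SpinSystem G q} (hS : S.WellDefined) (Λ : Finset V)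
    (v : V) : (if v ∈ Λ then S.blockKernel {v} else 1)
      ∈ Matrix.rowStochastic ℝ (V → Fin q) := by
  split_ifs
  · exact blockKernel_mem_rowStochastic hS _
  · exact one_mem _

theorem glauberOn_mem_rowStochastic [Nonempty V] {S : SpinSystem G q} (hS : S.WellDefined)
    (Λ : Finset V) : S.glauberOn Λ ∈ Matrix.rowStochastic ℝ (V → Fin q) :=
  average_mem_rowStochastic fun v => siteKernel_mem_rowStochastic hS Λ v

theorem gibbs_nonneg (S : SpinSystem G q) (X : V → Fin q) : 0 ≤ S.gibbs X := by
  rw [← S.pinnedGibbs_univ X]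
  exact S.pinnedGibbs_nonneg _ _ _

theorem gibbs_detailed_balance (S : SpinSystem G q) (Λ : Finset V) (X Y : V → Fin q) :
    S.gibbs X * S.blockKernel Λ X Y = S.gibbs Y * S.blockKernel Λ Y X := by
  simpa only [S.pinnedGibbs_univ] using S.detailed_balance (Finset.subset_univ Λ) X X Y

/-! ### Censoring -/

/-- Increasing observables. -/
def Increasing (ord : V → LinearOrder (Fin q)) (f : (V → Fin q) → ℝ) : Prop :=
  ∀ X Y, ConfigLE ord X Y → f X ≤ f Y

/-- The inner product of `L²(μ)`. -/
def gibbsInner (S : SpinSystem G q) (f g : (V → Fin q) → ℝ) : ℝ := ∑ X, S.gibbs X * (f X * g X)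

/-- Self-adjointness with respect to `μ`. -/
def Reversible (S : SpinSystem G q) (Q : Matrix (V → Fin q) (V → Fin q) ℝ) : Prop :=
  ∀ f g, S.gibbsInner (Q.mulVec f) g = S.gibbsInner f (Q.mulVec g)

theorem gibbsInner_comm (S : SpinSystem G q) (f g : (V → Fin q) → ℝ) :
    S.gibbsInner f g = S.gibbsInner g f := by
  simp only [gibbsInner, mul_comm (f _)]

theorem reversible_of_detailed_balance {S : SpinSystem G q}
    {Q : Matrix (V → Fin q) (V → Fin q) ℝ}
    (h : ∀ X Y, S.gibbs X * Q X Y = S.gibbs Y * Q Y X) : S.Reversible Q := by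
  intro f g
  simp only [gibbsInner, Matrix.mulVec, dotProduct, Finset.sum_mul, Finset.mul_sum]
  rw [Finset.sum_comm]
  refine Finset.sum_congr rfl fun Y _ => Finset.sum_congr rfl fun X _ => ?_
  linear_combination (f Y * g X) * h X Y

theorem Reversible.pow {S : SpinSystem G q} {Q : Matrix (V → Fin q) (V → Fin q) ℝ}
    (hQ : S.Reversible Q) (m : ℕ) : S.Reversible (Q ^ m) := by
  induction m with
  | zero => intro f g; simp
  | succ m ih =>
    intro f g
    rw [pow_succ, ← Matrix.mulVec_mulVec, ih, hQ, Matrix.mulVec_mulVec, ← pow_succ', pow_succ]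

theorem gibbsInner_average (S : SpinSystem G q) {ι : Type*} [Fintype ι]
    (Q : ι → Matrix (V → Fin q) (V → Fin q) ℝ) (f g : (V → Fin q) → ℝ) :
    S.gibbsInner f (((Fintype.card ι : ℝ)⁻¹ • ∑ i, Q i).mulVec g)
      = (Fintype.card ι : ℝ)⁻¹ * ∑ i, S.gibbsInner f ((Q i).mulVec g) := by
  simp only [gibbsInner, average_mulVec]
  rw [Finset.sum_comm, Finset.mul_sum]
  refine Finset.sum_congr rfl fun X _ => ?_
  rw [← Finset.mul_sum, ← Finset.mul_sum]
  ring

theorem reversible_average {S : SpinSystem G q} {ι : Type*} [Fintype ι]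
    {Q : ι → Matrix (V → Fin q) (V → Fin q) ℝ} (h : ∀ i, S.Reversible (Q i)) :
    S.Reversible ((Fintype.card ι : ℝ)⁻¹ • ∑ i, Q i) := by
  intro f g
  rw [gibbsInner_comm, gibbsInner_average, gibbsInner_average]
  simp only [fun i => gibbsInner_comm S g ((Q i).mulVec f), fun i => h i f g]

theorem increasing_average {ord : V → LinearOrder (Fin q)} {ι : Type*} [Fintype ι]
    {Q : ι → Matrix (V → Fin q) (V → Fin q) ℝ} {f : (V → Fin q) → ℝ}
    (h : ∀ i, Increasing ord ((Q i).mulVec f)) :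
    Increasing ord (((Fintype.card ι : ℝ)⁻¹ • ∑ i, Q i).mulVec f) := by
  intro X Y hXY
  rw [average_mulVec, average_mulVec]
  exact mul_le_mul_of_nonneg_left (Finset.sum_le_sum fun i _ => h i X Y hXY) (by positivity)

theorem increasing_blockKernel_singleton {S : SpinSystem G q} {ord : V → LinearOrder (Fin q)}
    (hm : S.IsMonotone ord) (v : V) {f : (V → Fin q) → ℝ} (hf : Increasing ord f) :
    Increasing ord ((S.blockKernel {v}).mulVec f) := by
  intro X Y hXY
  obtain ⟨π, hπ, hle⟩ := hm v X Y hXY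
  simp only [Matrix.mulVec, dotProduct, blockKernel]
  have h1 : ∑ A, S.pinnedGibbs {v} X A * f A = ∑ A, ∑ B, π A B * f A :=
    Finset.sum_congr rfl fun A _ => by rw [← hπ.fst, Finset.sum_mul]
  have h2 : ∑ B, S.pinnedGibbs {v} Y B * f B = ∑ A, ∑ B, π A B * f B := by
    rw [Finset.sum_comm]
    exact Finset.sum_congr rfl fun B _ => by rw [← hπ.snd, Finset.sum_mul]
  rw [h1, h2]
  refine Finset.sum_le_sum fun A _ => Finset.sum_le_sum fun B _ => ?_
  by_cases h : π A B = 0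
  · simp [h]
  · exact mul_le_mul_of_nonneg_left (hf A B (hle A B h)) (hπ.nonneg A B)

/-- Two configurations that differ from `X` only at `v` are comparable. -/
theorem configLE_total {U : Type*} (ord : U → LinearOrder (Fin q)) {v : U} {X Y Z : U → Fin q}
    (hY : ∀ u, u ∉ ({v} : Finset U) → Y u = X u) (hZ : ∀ u, u ∉ ({v} : Finset U) → Z u = X u) :
    ConfigLE ord Y Z ∨ ConfigLE ord Z Y := by
  refine ((ord v).le_total (Y v) (Z v)).imp (fun h u => ?_) fun h u => ?_ <;>
  · by_cases hu : u = v
    · exact hu ▸ h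
    · rw [hY u (by simpa using hu), hZ u (by simpa using hu)]
      exact (ord u).le_refl _

/-- Chebyshev's correlation inequality for a single-site update. -/
theorem mulVec_mul_mulVec_le {S : SpinSystem G q} (hS : S.WellDefined)
    {ord : V → LinearOrder (Fin q)} (v : V) {f g : (V → Fin q) → ℝ} (hf : Increasing ord f)
    (hg : Increasing ord g) (X : V → Fin q) :
    (S.blockKernel {v}).mulVec f X * (S.blockKernel {v}).mulVec g X
      ≤ (S.blockKernel {v}).mulVec (fun Y => f Y * g Y) X := by
  simp only [Matrix.mulVec, dotProduct]
  set p : (V → Fin q) → ℝ := fun Y => S.blockKernel {v} X Y with hp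
  have hp1 : ∑ Y, p Y = 1 := sum_pinnedGibbs hS {v} X
  -- Twice the covariance, written with two independent copies. Both copies agree with `X` off `v`,
  -- so they are comparable and the two differences have the same sign.
  have hnn : 0 ≤ ∑ Y, ∑ Z, p Y * p Z * ((f Y - f Z) * (g Y - g Z)) := by
    refine Finset.sum_nonneg fun Y _ => Finset.sum_nonneg fun Z _ => ?_
    by_cases hY : p Y = 0
    · simp [hY]
    by_cases hZ : p Z = 0
    · simp [hZ]
    refine mul_nonneg (mul_nonneg (S.pinnedGibbs_nonneg _ _ _) (S.pinnedGibbs_nonneg _ _ _)) ?_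
    rcases configLE_total ord (S.agree_of_blockKernel_ne_zero hY)
      (S.agree_of_blockKernel_ne_zero hZ) with h | h
    · exact mul_nonneg_of_nonpos_of_nonpos (sub_nonpos.2 (hf _ _ h)) (sub_nonpos.2 (hg _ _ h))
    · exact mul_nonneg (sub_nonneg.2 (hf _ _ h)) (sub_nonneg.2 (hg _ _ h))
  have hexp : ∑ Y, ∑ Z, p Y * p Z * ((f Y - f Z) * (g Y - g Z))
      = 2 * ((∑ Y, p Y) * ∑ Y, p Y * (f Y * g Y)) - 2 * ((∑ Y, p Y * f Y) * ∑ Y, p Y * g Y) := by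
    have e1 : ∑ Y, ∑ Z, p Y * p Z * ((f Y - f Z) * (g Y - g Z))
        = ∑ Y, ∑ Z, p Y * (f Y * g Y) * p Z + ∑ Y, ∑ Z, p Y * (p Z * (f Z * g Z))
          - ∑ Y, ∑ Z, (p Y * f Y) * (p Z * g Z) - ∑ Y, ∑ Z, (p Y * g Y) * (p Z * f Z) := by
      simp only [← Finset.sum_add_distrib, ← Finset.sum_sub_distrib]
      refine Finset.sum_congr rfl fun Y _ => Finset.sum_congr rfl fun Z _ => ?_
      ring
    rw [e1]
    simp only [← Finset.sum_mul_sum]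
    ring
  rw [hexp, hp1] at hnn
  linarith

/-- The basic censoring inequality. The kernel `P` is a self-adjoint projection preserving `μ`, so
the left side is the mean of `(P f) (P g)` and the right side that of `P (f g)`; these compare
pointwise. -/
theorem gibbsInner_blockKernel_le {S : SpinSystem G q} (hS : S.WellDefined)
    {ord : V → LinearOrder (Fin q)} (v : V) {f g : (V → Fin q) → ℝ} (hf : Increasing ord f)
    (hg : Increasing ord g) :
    S.gibbsInner f ((S.blockKernel {v}).mulVec g) ≤ S.gibbsInner f g := by
  have hrev : S.Reversible (S.blockKernel {v}) :=
    reversible_of_detailed_balance (S.gibbs_detailed_balance {v})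
  have h1 : S.gibbsInner f ((S.blockKernel {v}).mulVec g)
      = S.gibbsInner ((S.blockKernel {v}).mulVec f) ((S.blockKernel {v}).mulVec g) := by
    rw [hrev, Matrix.mulVec_mulVec, blockKernel_mul_of_subset hS subset_rfl]
  have h2 : S.gibbsInner f g
      = S.gibbsInner 1 ((S.blockKernel {v}).mulVec fun Y => f Y * g Y) := by
    rw [← hrev, Matrix.one_vecMul_of_mem_rowStochastic (blockKernel_mem_rowStochastic hS {v})]
    simp [gibbsInner]
  rw [h1, h2]
  refine Finset.sum_le_sum fun X _ => mul_le_mul_of_nonneg_left ?_ (S.gibbs_nonneg X)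
  simpa using mulVec_mul_mulVec_le hS v hf hg X

/-- `Q` is a mixture of censored versions of `m` steps of the Glauber dynamics; this records the
properties that the comparison with the uncensored dynamics rests on. -/
structure Censored (S : SpinSystem G q) (ord : V → LinearOrder (Fin q)) (m : ℕ)
    (Q : Matrix (V → Fin q) (V → Fin q) ℝ) : Prop where
  stochastic : Q ∈ Matrix.rowStochastic ℝ (V → Fin q)
  support : ∀ X Y, 0 < S.gibbs X → Q X Y ≠ 0 → 0 < S.gibbs Y
  increasing : ∀ f, Increasing ord f → Increasing ord (Q.mulVec f)
  le : ∀ f g, Increasing ord f → Increasing ord g →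
    S.gibbsInner f ((S.glauberOn Finset.univ ^ m).mulVec g) ≤ S.gibbsInner f (Q.mulVec g)

theorem reversible_glauberOn (S : SpinSystem G q) (Λ : Finset V) :
    S.Reversible (S.glauberOn Λ) := by
  refine reversible_average fun v => ?_
  split_ifs
  · exact reversible_of_detailed_balance (S.gibbs_detailed_balance {v})
  · intro f g; simp

theorem increasing_siteKernel {S : SpinSystem G q} {ord : V → LinearOrder (Fin q)}
    (hm : S.IsMonotone ord) (Λ : Finset V) (v : V) {f : (V → Fin q) → ℝ}
    (hf : Increasing ord f) :
    Increasing ord ((if v ∈ Λ then S.blockKernel {v} else 1).mulVec f) := by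
  split_ifs
  · exact increasing_blockKernel_singleton hm v hf
  · simpa using hf

theorem increasing_glauberOn_pow {S : SpinSystem G q} {ord : V → LinearOrder (Fin q)}
    (hm : S.IsMonotone ord) (Λ : Finset V) (m : ℕ) {f : (V → Fin q) → ℝ}
    (hf : Increasing ord f) : Increasing ord ((S.glauberOn Λ ^ m).mulVec f) := by
  induction m with
  | zero => simpa using hf
  | succ m ih =>
    rw [pow_succ', ← Matrix.mulVec_mulVec]
    exact increasing_average fun v => increasing_siteKernel hm Λ v ih

theorem censored_one (S : SpinSystem G q) (ord : V → LinearOrder (Fin q)) :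
    S.Censored ord 0 1 where
  stochastic := one_mem _
  support X Y hX h := by
    by_cases hXY : X = Y
    · exact hXY ▸ hX
    · exact absurd (Matrix.one_apply_ne hXY) h
  increasing f hf := by simpa using hf
  le f g _ _ := by simp

/-- The factors are replaced one at a time. Reversibility moves the first `m₁` steps onto `f`, which
stays increasing, while `Q₂` is put in; then they return to be replaced by `Q₁`, acting on the
increasing function `Q₂ g`. -/
theorem Censored.mul {S : SpinSystem G q} {ord : V → LinearOrder (Fin q)}
    (hm : S.IsMonotone ord) {m₁ m₂ : ℕ} {Q₁ Q₂ : Matrix (V → Fin q) (V → Fin q) ℝ}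
    (h₁ : S.Censored ord m₁ Q₁) (h₂ : S.Censored ord m₂ Q₂) :
    S.Censored ord (m₁ + m₂) (Q₁ * Q₂) where
  stochastic := mul_mem h₁.stochastic h₂.stochastic
  support X Y hX h := by
    rw [Matrix.mul_apply] at h
    obtain ⟨Z, -, hZ⟩ := Finset.exists_ne_zero_of_sum_ne_zero h
    exact h₂.support Z Y (h₁.support X Z hX (left_ne_zero_of_mul hZ)) (right_ne_zero_of_mul hZ)
  increasing f hf := by
    rw [← Matrix.mulVec_mulVec]
    exact h₁.increasing _ (h₂.increasing f hf)
  le f g hf hg := by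
    have hrev := (S.reversible_glauberOn Finset.univ).pow m₁
    calc S.gibbsInner f ((S.glauberOn Finset.univ ^ (m₁ + m₂)).mulVec g)
        = S.gibbsInner ((S.glauberOn Finset.univ ^ m₁).mulVec f)
            ((S.glauberOn Finset.univ ^ m₂).mulVec g) := by
          rw [pow_add, ← Matrix.mulVec_mulVec, hrev]
      _ ≤ S.gibbsInner ((S.glauberOn Finset.univ ^ m₁).mulVec f) (Q₂.mulVec g) :=
          h₂.le _ g (increasing_glauberOn_pow hm _ m₁ hf) hg
      _ = S.gibbsInner f ((S.glauberOn Finset.univ ^ m₁).mulVec (Q₂.mulVec g)) := hrev _ _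
      _ ≤ S.gibbsInner f ((Q₁ * Q₂).mulVec g) := by
          rw [← Matrix.mulVec_mulVec]
          exact h₁.le f _ hf (h₂.increasing g hg)

theorem Censored.pow {S : SpinSystem G q} {ord : V → LinearOrder (Fin q)}
    (hm : S.IsMonotone ord) {m : ℕ} {Q : Matrix (V → Fin q) (V → Fin q) ℝ}
    (h : S.Censored ord m Q) (t : ℕ) : S.Censored ord (t * m) (Q ^ t) := by
  induction t with
  | zero => simpa using S.censored_one ord
  | succ t ih =>
    rw [pow_succ, Nat.succ_mul]
    exact ih.mul hm h

theorem Censored.average {S : SpinSystem G q} {ord : V → LinearOrder (Fin q)}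
    {ι : Type*} [Fintype ι] [Nonempty ι] {m : ℕ} {Q : ι → Matrix (V → Fin q) (V → Fin q) ℝ}
    (h : ∀ i, S.Censored ord m (Q i)) :
    S.Censored ord m ((Fintype.card ι : ℝ)⁻¹ • ∑ i, Q i) where
  stochastic := average_mem_rowStochastic fun i => (h i).stochastic
  support X Y hX hQ := by
    rw [Matrix.smul_apply, Matrix.sum_apply, smul_eq_mul] at hQ
    obtain ⟨i, -, hi⟩ := Finset.exists_ne_zero_of_sum_ne_zero (right_ne_zero_of_mul hQ)
    exact (h i).support X Y hX hi
  increasing f hf := increasing_average fun i => (h i).increasing f hf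
  le f g hf hg := by
    rw [gibbsInner_average]
    refine le_trans (le_of_eq ?_) (mul_le_mul_of_nonneg_left
      (Finset.sum_le_sum fun i _ => (h i).le f g hf hg) (by positivity))
    rw [Finset.sum_const, Finset.card_univ, nsmul_eq_mul, inv_mul_cancel_left₀]
    exact_mod_cast Fintype.card_ne_zero

theorem censored_glauberOn [Nonempty V] {S : SpinSystem G q} (hS : S.WellDefined)
    {ord : V → LinearOrder (Fin q)} (hm : S.IsMonotone ord) (Λ : Finset V) :
    S.Censored ord 1 (S.glauberOn Λ) where
  stochastic := glauberOn_mem_rowStochastic hS Λ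
  support X Y hX h := by
    rw [← S.pinnedGibbs_univ X] at hX ⊢
    exact S.pinnedGibbs_pos_of_glauberOn (Finset.subset_univ Λ) hX h
  increasing f hf := by
    simpa using increasing_glauberOn_pow hm Λ 1 hf
  le f g hf hg := by
    rw [pow_one, glauberOn, glauberOn, gibbsInner_average, gibbsInner_average]
    refine mul_le_mul_of_nonneg_left (Finset.sum_le_sum fun v _ => ?_) (by positivity)
    rw [if_pos (Finset.mem_univ v)]
    split_ifs
    · exact le_rfl
    · simpa using gibbsInner_blockKernel_le hS v hf hg

/-! ### Comparison in total variation from the maximum configuration -/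

theorem abs_mulVec_sub_le {Ω : Type*} [Fintype Ω] [DecidableEq Ω] {Q : Matrix Ω Ω ℝ}
    (hQ : Q ∈ Matrix.rowStochastic ℝ Ω) {f : Ω → ℝ} {X : Ω} {c a : ℝ}
    (h : ∀ Y, Q X Y ≠ 0 → |f Y - c| ≤ a) : |Q.mulVec f X - c| ≤ a := by
  have h1 : Q.mulVec f X - c = ∑ Y, Q X Y * (f Y - c) := by
    simp only [mul_sub, Finset.sum_sub_distrib, ← Finset.sum_mul,
      Matrix.sum_row_of_mem_rowStochastic hQ X, one_mul]
    rfl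
  rw [h1]
  calc |∑ Y, Q X Y * (f Y - c)| ≤ ∑ Y, |Q X Y * (f Y - c)| := Finset.abs_sum_le_sum_abs _ _
    _ ≤ ∑ Y, Q X Y * a := by
        refine Finset.sum_le_sum fun Y _ => ?_
        rw [abs_mul, abs_of_nonneg (Matrix.nonneg_of_mem_rowStochastic hQ)]
        by_cases h0 : Q X Y = 0
        · simp [h0]
        · exact mul_le_mul_of_nonneg_left (h Y h0) (Matrix.nonneg_of_mem_rowStochastic hQ)
    _ = a := by rw [← Finset.sum_mul, Matrix.sum_row_of_mem_rowStochastic hQ X, one_mul]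

theorem mulVec_mem_Icc {Ω : Type*} [Fintype Ω] [DecidableEq Ω] {Q : Matrix Ω Ω ℝ}
    (hQ : Q ∈ Matrix.rowStochastic ℝ Ω) {f : Ω → ℝ} (hf : ∀ Y, f Y ∈ Set.Icc (0 : ℝ) 1) (X : Ω) :
    Q.mulVec f X ∈ Set.Icc (0 : ℝ) 1 := by
  have := abs_mulVec_sub_le hQ (X := X) (c := 1 / 2) (a := 1 / 2) (f := f) fun Y _ => by
    obtain ⟨h1, h2⟩ := hf Y
    rw [abs_le]
    constructor <;> linarith
  rw [abs_le] at this
  constructor <;> linarith [this.1, this.2]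

/-- `A` and `B` differ by at most `δ` in total variation, started from any state in `Ω(μ)`. -/
def Near (S : SpinSystem G q) (A B : Matrix (V → Fin q) (V → Fin q) ℝ) (δ : ℝ) : Prop :=
  ∀ X, 0 < S.gibbs X → ∀ f : (V → Fin q) → ℝ, (∀ Y, f Y ∈ Set.Icc (0 : ℝ) 1) →
    |A.mulVec f X - B.mulVec f X| ≤ δ

/-- Started from the maximum configuration, the Glauber dynamics is at least as close to
equilibrium as any of its censored versions. -/
theorem tvDist_glauber_pow_le {S : SpinSystem G q} (hS : S.WellDefined)
    {ord : V → LinearOrder (Fin q)} [Nonempty V] (hm : S.IsMonotone ord) {X : V → Fin q}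
    (hX : S.IsMaxConfig ord X) {m : ℕ} {Q : Matrix (V → Fin q) (V → Fin q) ℝ} {δ : ℝ}
    (hQ : S.Censored ord m Q) (hδ : S.Near Q (S.blockKernel Finset.univ) δ) :
    tvDist ((glauber S.gibbs ^ m) X) S.gibbs ≤ δ := by
  classical
  set K := S.glauberOn Finset.univ ^ m with hK
  have hKs : K ∈ Matrix.rowStochastic ℝ (V → Fin q) :=
    pow_mem (glauberOn_mem_rowStochastic hS _) m
  have hKX : ∀ Y, (glauber S.gibbs ^ m) X Y = K X Y := by
    intro Y
    have := S.glauber_pow_pinnedGibbs_apply (Λ := Finset.univ) (τ := X) m (X := X)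
      (by rw [S.pinnedGibbs_univ]; exact hX.1) Y
    rwa [S.pinnedGibbs_univ] at this
  -- An increasing function that on the support is the indicator of `X` alone, so pairing with it
  -- evaluates at `X`.
  set h : (V → Fin q) → ℝ := fun Y => if ConfigLE ord X Y then 1 else 0 with hh
  have hinc : Increasing ord h := by
    intro Y Z hYZ
    simp only [hh]
    split_ifs with h1 h2
    · exact le_rfl
    · exact absurd (fun v => (ord v).le_trans _ _ _ (h1 v) (hYZ v)) h2
    · exact zero_le_one
    · exact le_rfl
  have hinner : ∀ F, S.gibbsInner h F = S.gibbs X * F X := by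
    intro F
    rw [gibbsInner, Finset.sum_eq_single X]
    · simp only [hh]
      rw [if_pos (show ConfigLE ord X X from fun v => (ord v).le_refl _), one_mul]
    · intro Y _ hYX
      rcases (S.gibbs_nonneg Y).eq_or_lt with h0 | h0
      · rw [← h0, zero_mul]
      · simp only [hh]
        rw [if_neg, zero_mul, mul_zero]
        intro hle
        exact hYX (funext fun v => (ord v).le_antisymm _ _ (hX.2 Y h0 v) (hle v))
    · simp
  have hrev : S.Reversible K := (S.reversible_glauberOn _).pow m
  -- By reversibility the density of the law `K X` with respect to `μ` is `K h / μ(X)`, an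
  -- increasing function.
  have hdens : ∀ Y, S.gibbs X * K X Y = S.gibbs Y * K.mulVec h Y := by
    intro Y
    have h1 := hinner (K.mulVec (Pi.single Y 1))
    rw [← hrev, Matrix.mulVec_single_one] at h1
    rw [← Matrix.col_apply K Y X, ← h1, gibbsInner, Finset.sum_eq_single Y]
    · simp
    · intro Z _ hZ
      simp [hZ]
    · simp
  -- The event that the density is at least one: it is increasing and attains the total variation
  -- distance.
  set g : (V → Fin q) → ℝ := fun Y => if S.gibbs X ≤ K.mulVec h Y then 1 else 0 with hg
  have hginc : Increasing ord g := by
    intro Y Z hYZ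
    simp only [hg]
    split_ifs with h1 h2
    · exact le_rfl
    · exact absurd (h1.trans (increasing_glauberOn_pow hm _ m hinc Y Z hYZ)) h2
    · exact zero_le_one
    · exact le_rfl
  have hg01 : ∀ Y, g Y ∈ Set.Icc (0 : ℝ) 1 := by
    intro Y
    simp only [hg]
    split_ifs <;> simp
  have habs : ∀ Y, |K X Y - S.gibbs Y| = 2 * ((K X Y - S.gibbs Y) * g Y) - (K X Y - S.gibbs Y) := by
    intro Y
    have e : S.gibbs X * (K X Y - S.gibbs Y) = S.gibbs Y * (K.mulVec h Y - S.gibbs X) := by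
      rw [mul_sub, mul_sub, hdens]; ring
    simp only [hg]
    split_ifs with h1
    · have : 0 ≤ K X Y - S.gibbs Y := by
        refine nonneg_of_mul_nonneg_right (a := S.gibbs X) ?_ hX.1
        rw [e]
        exact mul_nonneg (S.gibbs_nonneg Y) (sub_nonneg.2 h1)
      rw [abs_of_nonneg this]; ring
    · have : K X Y - S.gibbs Y ≤ 0 := by
        refine nonpos_of_mul_nonpos_right (a := S.gibbs X) ?_ hX.1
        rw [e]
        exact mul_nonpos_of_nonneg_of_nonpos (S.gibbs_nonneg Y) (sub_nonpos.2 (not_le.1 h1).le)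
      rw [abs_of_nonpos this]; ring
  have hsumK : ∑ Y, K X Y = 1 := Matrix.sum_row_of_mem_rowStochastic hKs X
  have hsumμ : ∑ Y, S.gibbs Y = 1 := by
    rw [← S.pinnedGibbs_univ X]
    exact sum_pinnedGibbs hS _ _
  have htv : tvDist ((glauber S.gibbs ^ m) X) S.gibbs
      = K.mulVec g X - (S.blockKernel Finset.univ).mulVec g X := by
    have hb : (S.blockKernel Finset.univ).mulVec g X = ∑ Y, S.gibbs Y * g Y := by
      simp only [Matrix.mulVec, dotProduct, blockKernel, S.pinnedGibbs_univ]
    rw [tvDist, hb]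
    simp only [hKX, habs, Finset.sum_sub_distrib, ← Finset.mul_sum, hsumK, hsumμ, sub_mul]
    simp only [Matrix.mulVec, dotProduct]
    ring
  rw [htv]
  have hle : K.mulVec g X ≤ Q.mulVec g X := by
    have := hQ.le h g hinc hginc
    rw [hinner, hinner] at this
    exact le_of_mul_le_mul_left this hX.1
  have := (abs_le.1 (hδ X hX.1 g hg01)).2
  linarith

/-! ### Simulation of a block update by the dynamics inside the block -/

theorem exists_tvDist_le_of_mixTimeFrom_le {ν : (V → Fin q) → ℝ} {ε : ℝ} {X : V → Fin q} {T : ℕ}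
    (h : mixTimeFrom ν ε X ≤ T) : ∃ t ≤ T, tvDist ((glauber ν ^ t) X) ν ≤ ε := by
  by_contra! hc
  have : ((T + 1 : ℕ) : ℕ∞) ≤ mixTimeFrom ν ε X := by
    refine le_iInf₂ fun t ht => ?_
    rw [Nat.cast_le]
    by_contra hlt
    exact absurd ht.2 (not_le.2 (hc t (by omega)))
  have := this.trans h
  rw [Nat.cast_le] at this
  omega

theorem pinnedGibbs_self_pos {S : SpinSystem G q} (hS : S.WellDefined) (Λ : Finset V)
    {X : V → Fin q} (hX : 0 < S.gibbs X) : 0 < S.pinnedGibbs Λ X X := by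
  obtain ⟨R, -, hw⟩ := S.exists_pinnedWeight_eq_mul (Finset.subset_univ Λ) X
  refine div_pos ((S.pinnedWeight_nonneg _ _ _).lt_of_ne' fun h0 => ?_) (hS Λ X)
  rw [← S.pinnedGibbs_univ X, pinnedGibbs, hw, h0, mul_zero, zero_div] at hX
  exact hX.ne rfl

theorem pinnedGibbs_pos_of_glauberOn_pow (S : SpinSystem G q) {Λ : Finset V} {τ : V → Fin q}
    (t : ℕ) {X Y : V → Fin q} (hX : 0 < S.pinnedGibbs Λ τ X) (h : (S.glauberOn Λ ^ t) X Y ≠ 0) :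
    0 < S.pinnedGibbs Λ τ Y := by
  induction t generalizing X with
  | zero =>
    by_cases hXY : X = Y
    · exact hXY ▸ hX
    · exact absurd (by rw [pow_zero, Matrix.one_apply_ne hXY]) h
  | succ t ih =>
    rw [pow_succ', Matrix.mul_apply] at h
    obtain ⟨Z, -, hZ⟩ := Finset.exists_ne_zero_of_sum_ne_zero h
    exact ih (S.pinnedGibbs_pos_of_glauberOn subset_rfl hX (left_ne_zero_of_mul hZ))
      (right_ne_zero_of_mul hZ)

theorem blockKernel_mul_glauberOn_pow [Nonempty V] {S : SpinSystem G q} (hS : S.WellDefined)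
    (Λ : Finset V) (t : ℕ) : S.blockKernel Λ * S.glauberOn Λ ^ t = S.blockKernel Λ := by
  induction t with
  | zero => simp
  | succ t ih => rw [pow_succ, ← mul_assoc, ih, blockKernel_mul_glauberOn hS]

/-- Running the dynamics on `Λ` for its mixing time halves the deviation from the mean. -/
theorem abs_glauberOn_pow_sub_le [Nonempty V] {S : SpinSystem G q} (hS : S.WellDefined)
    {Λ : Finset V} {τ : V → Fin q} {T : ℕ}
    (hT : mixTime (S.pinnedGibbs Λ τ) (1 / (4 * Real.exp 1)) ≤ T) {f : (V → Fin q) → ℝ} {a : ℝ}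
    (hf : ∀ Y, 0 < S.pinnedGibbs Λ τ Y → |f Y - (S.blockKernel Λ).mulVec f τ| ≤ a)
    {Y : V → Fin q} (hY : 0 < S.pinnedGibbs Λ τ Y) :
    |(S.glauberOn Λ ^ T).mulVec f Y - (S.blockKernel Λ).mulVec f τ| ≤ a / 2 := by
  have ha : 0 ≤ a := (abs_nonneg _).trans (hf Y hY)
  obtain ⟨t, htT, htv⟩ := exists_tvDist_le_of_mixTimeFrom_le
    ((le_iSup₂_of_le (f := fun X (_ : 0 < S.pinnedGibbs Λ τ X) =>
      mixTimeFrom (S.pinnedGibbs Λ τ) (1 / (4 * Real.exp 1)) X) Y hY le_rfl).trans hT)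
  set c := (S.blockKernel Λ).mulVec f τ with hc
  -- The bound on the distance is known at some time `t ≤ T`; the remaining `T - t` steps are
  -- absorbed into the test function, which changes neither its mean nor the bound `a`.
  set F := (S.glauberOn Λ ^ (T - t)).mulVec f with hF
  have hst := fun j => pow_mem (glauberOn_mem_rowStochastic hS Λ) j
  have hFa : ∀ Z, 0 < S.pinnedGibbs Λ τ Z → |F Z - c| ≤ a := fun Z hZ =>
    abs_mulVec_sub_le (hst _) fun W hW => hf W (S.pinnedGibbs_pos_of_glauberOn_pow _ hZ hW)
  have hFc : ∑ Z, S.pinnedGibbs Λ τ Z * F Z = c := by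
    have : (S.blockKernel Λ).mulVec F τ = c := by
      rw [hF, Matrix.mulVec_mulVec, blockKernel_mul_glauberOn_pow hS]
    exact this
  have h1 : (S.glauberOn Λ ^ T).mulVec f Y - c
      = ∑ Z, ((S.glauberOn Λ ^ t) Y Z - S.pinnedGibbs Λ τ Z) * (F Z - c) := by
    have e : (S.glauberOn Λ ^ T).mulVec f Y = ∑ Z, (S.glauberOn Λ ^ t) Y Z * F Z := by
      rw [show T = t + (T - t) by omega, pow_add, ← Matrix.mulVec_mulVec]
      rfl
    have e2 := Matrix.sum_row_of_mem_rowStochastic (hst t) Y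
    simp only [sub_mul, mul_sub, Finset.sum_sub_distrib, ← Finset.sum_mul, hFc,
      sum_pinnedGibbs hS Λ τ, ← e, e2]
    ring
  rw [h1]
  calc |∑ Z, ((S.glauberOn Λ ^ t) Y Z - S.pinnedGibbs Λ τ Z) * (F Z - c)|
      ≤ ∑ Z, |((S.glauberOn Λ ^ t) Y Z - S.pinnedGibbs Λ τ Z) * (F Z - c)| :=
        Finset.abs_sum_le_sum_abs _ _
    _ ≤ ∑ Z, |(S.glauberOn Λ ^ t) Y Z - S.pinnedGibbs Λ τ Z| * a := by
        refine Finset.sum_le_sum fun Z _ => ?_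
        rw [abs_mul]
        rcases (S.pinnedGibbs_nonneg Λ τ Z).eq_or_lt with h0 | h0
        · have : (S.glauberOn Λ ^ t) Y Z = 0 := by
            by_contra hne
            exact (S.pinnedGibbs_pos_of_glauberOn_pow t hY hne).ne h0
          simp [this, ← h0]
        · exact mul_le_mul_of_nonneg_left (hFa Z h0) (abs_nonneg _)
    _ = tvDist ((glauber (S.pinnedGibbs Λ τ) ^ t) Y) (S.pinnedGibbs Λ τ) * (2 * a) := by
        rw [← Finset.sum_mul, tvDist]
        simp only [S.glauber_pow_pinnedGibbs_apply t hY]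
        ring
    -- Of the threshold `1 / (4 e)` only the bound by `1 / 4` is used.
    _ ≤ 1 / 4 * (2 * a) := by
        refine mul_le_mul_of_nonneg_right (htv.trans ?_) (by linarith)
        exact one_div_le_one_div_of_le (by norm_num)
          (by nlinarith [Real.add_one_le_exp (1 : ℝ)])
    _ = a / 2 := by ring

theorem near_glauberOn_pow [Nonempty V] {S : SpinSystem G q} (hS : S.WellDefined) {Λ : Finset V}
    {T : ℕ} (hT : ∀ τ, mixTime (S.pinnedGibbs Λ τ) (1 / (4 * Real.exp 1)) ≤ T) (t : ℕ) :
    S.Near (S.glauberOn Λ ^ (t * T)) (S.blockKernel Λ) ((1 / 2) ^ t) := by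
  intro X hX f hf
  -- The halving step needs the deviation at every state in the support of the pinned distribution,
  -- so the induction covers all of them.
  suffices h : ∀ Y, 0 < S.pinnedGibbs Λ X Y →
      |(S.glauberOn Λ ^ (t * T)).mulVec f Y - (S.blockKernel Λ).mulVec f X| ≤ (1 / 2) ^ t from
    h X (pinnedGibbs_self_pos hS Λ hX)
  induction t with
  | zero =>
    intro Y _
    have h1 := hf Y
    have h2 := mulVec_mem_Icc (blockKernel_mem_rowStochastic hS Λ) hf X
    simp only [zero_mul, pow_zero, Matrix.one_mulVec]
    rw [abs_le]
    constructor <;> linarith [h1.1, h1.2, h2.1, h2.2]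
  | succ t ih =>
    intro Y hY
    have hc : (S.blockKernel Λ).mulVec ((S.glauberOn Λ ^ (t * T)).mulVec f) X
        = (S.blockKernel Λ).mulVec f X := by
      rw [Matrix.mulVec_mulVec, blockKernel_mul_glauberOn_pow hS]
    have := abs_glauberOn_pow_sub_le hS (hT X) (f := (S.glauberOn Λ ^ (t * T)).mulVec f)
      (a := (1 / 2) ^ t) (fun Z hZ => by rw [hc]; exact ih Z hZ) hY
    rw [hc, Matrix.mulVec_mulVec, ← pow_add] at this
    rw [Nat.succ_mul, add_comm, pow_succ]
    linarith

/-! ### Contraction of the block dynamics -/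

/-- Path coupling: disagreements are removed one vertex at a time. The intermediate configurations
need not lie in the support of `μ`. -/
theorem abs_sub_le_hammingDist {ρ : V → ℕ+} {Λ : Finset V} {f : (V → Fin q) → ℝ} {a : ℝ}
    (h : ∀ v ∈ Λ, ∀ X Y, (∀ u, u ≠ v → X u = Y u) → |f X - f Y| ≤ a * ((ρ v : ℕ) : ℝ))
    {X Y : V → Fin q} (hXY : ∀ v, v ∉ Λ → X v = Y v) :
    |f X - f Y| ≤ a * hammingDist ρ X Y := by
  have key : ∀ s : Finset V, s ⊆ Λ → ∀ X Y : V → Fin q, (∀ v, v ∉ s → X v = Y v) →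
      |f X - f Y| ≤ a * ∑ v ∈ s, ((ρ v : ℕ) : ℝ) := by
    intro s
    induction s using Finset.induction_on with
    | empty =>
      intro _ X Y hXY
      have : X = Y := funext fun v => hXY v (by simp)
      simp [this]
    | insert v s hv ih =>
      intro hs X Y hXY
      have h1 := h v (hs (Finset.mem_insert_self v s)) X (Function.update X v (Y v))
        fun u hu => by simp [hu]
      have h2 := ih ((Finset.subset_insert v s).trans hs) (Function.update X v (Y v)) Y fun u hu => by
        by_cases huv : u = v
        · subst huv; simp
        · simp [huv, hXY u (by simp [huv, hu])]
      rw [Finset.sum_insert hv, mul_add]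
      exact (abs_sub_le _ _ _).trans (add_le_add h1 h2)
  refine key _ (fun v hv => ?_) X Y fun v hv => ?_
  · by_contra hn
    exact (Finset.mem_filter.1 hv).2 (hXY v hn)
  · by_contra hn
    exact hv (Finset.mem_filter.2 ⟨Finset.mem_univ v, hn⟩)

/-- If `v ∈ B`, the disagreement is resampled and both laws coincide. Otherwise the pinnings off `B`
differ only at `v`, and the coupling of expected weight at most `M ρ(v)` applies. -/
theorem abs_blockKernel_sub_le {S : SpinSystem G q} {M : ℝ} {ρ : V → ℕ+}
    (hCI : S.CouplingIndependent M ρ) {Λ B : Finset V} (hB : B ⊆ Λ) {f : (V → Fin q) → ℝ} {a : ℝ}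
    (ha : 0 ≤ a)
    (h : ∀ X Y, (∀ v, v ∉ Λ → X v = Y v) → |f X - f Y| ≤ a * hammingDist ρ X Y)
    {v : V} (hv : v ∈ Λ) {X Y : V → Fin q} (hne : X v ≠ Y v) (hXY : ∀ u, u ≠ v → X u = Y u) :
    |(S.blockKernel B).mulVec f X - (S.blockKernel B).mulVec f Y|
      ≤ if v ∉ B then a * (M * ((ρ v : ℕ) : ℝ)) else 0 := by
  by_cases hvB : v ∉ B
  · rw [if_pos hvB]
    obtain ⟨π, hπ, hM⟩ := hCI B v X Y hvB hne fun u _ hu => hXY u hu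
    have hρ : (0 : ℝ) < ((ρ v : ℕ) : ℝ) := by exact_mod_cast (ρ v).pos
    rw [div_le_iff₀ hρ] at hM
    have h1 : (S.blockKernel B).mulVec f X = ∑ A, ∑ C, π A C * f A :=
      Finset.sum_congr rfl fun A _ => by
        rw [← Finset.sum_mul, hπ.fst]; rfl
    have h2 : (S.blockKernel B).mulVec f Y = ∑ A, ∑ C, π A C * f C := by
      rw [Finset.sum_comm]
      exact Finset.sum_congr rfl fun A _ => by
        rw [← Finset.sum_mul, hπ.snd]; rfl
    have h3 : ∀ A C, |π A C * f A - π A C * f C| ≤ a * (π A C * hammingDist ρ A C) := by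
      intro A C
      by_cases h0 : π A C = 0
      · simp [h0]
      have hA : S.blockKernel B X A ≠ 0 := by
        have : 0 < ∑ D, π A D := Finset.sum_pos' (fun D _ => hπ.nonneg A D)
          ⟨C, Finset.mem_univ C, (hπ.nonneg A C).lt_of_ne' h0⟩
        rw [hπ.fst] at this
        exact this.ne'
      have hC : S.blockKernel B Y C ≠ 0 := by
        have : 0 < ∑ D, π D C := Finset.sum_pos' (fun D _ => hπ.nonneg D C)
          ⟨A, Finset.mem_univ A, (hπ.nonneg A C).lt_of_ne' h0⟩
        rw [hπ.snd] at this
        exact this.ne'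
      -- The coupling charges only pairs that extend the two pinnings, and these agree off `Λ`
      -- because `v ∈ Λ` and `B ⊆ Λ`.
      have hAC := h A C fun u hu => by
        have huB : u ∉ B := fun h' => hu (hB h')
        rw [S.agree_of_blockKernel_ne_zero hA u huB, S.agree_of_blockKernel_ne_zero hC u huB]
        exact hXY u fun h' => hu (h' ▸ hv)
      rw [← mul_sub, abs_mul, abs_of_nonneg (hπ.nonneg A C)]
      calc π A C * |f A - f C| ≤ π A C * (a * hammingDist ρ A C) :=
            mul_le_mul_of_nonneg_left hAC (hπ.nonneg A C)
        _ = _ := by ring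
    rw [h1, h2, ← Finset.sum_sub_distrib]
    simp only [← Finset.sum_sub_distrib]
    calc |∑ A, ∑ C, (π A C * f A - π A C * f C)|
        ≤ ∑ A, ∑ C, |π A C * f A - π A C * f C| :=
          (Finset.abs_sum_le_sum_abs _ _).trans
            (Finset.sum_le_sum fun A _ => Finset.abs_sum_le_sum_abs _ _)
      _ ≤ ∑ A, ∑ C, a * (π A C * hammingDist ρ A C) :=
          Finset.sum_le_sum fun A _ => Finset.sum_le_sum fun C _ => h3 A C
      _ = a * ∑ A, ∑ C, π A C * hammingDist ρ A C := by simp only [Finset.mul_sum]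
      _ ≤ _ := mul_le_mul_of_nonneg_left hM ha
  · rw [if_neg hvB]
    have : S.pinnedGibbs B X = S.pinnedGibbs B Y :=
      S.pinnedGibbs_congr fun u hu => hXY u fun h' => hvB (h' ▸ hu)
    simp only [Matrix.mulVec, dotProduct, blockKernel, this, sub_self, abs_zero, le_refl]

/-- If every vertex of `Λ` is missed by at most a `1 / (2 M)` fraction of the blocks, then the
block dynamics contracts Lipschitz constants by `1 / 2`. -/
theorem block_dynamics_lipschitz {S : SpinSystem G q} {M : ℝ} {ρ : V → ℕ+}
    (hCI : S.CouplingIndependent M ρ) {ι : Type*} [Fintype ι] [Nonempty ι] {Λ : Finset V}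
    {B : ι → Finset V} (hB : ∀ i, B i ⊆ Λ)
    (hmiss : ∀ v ∈ Λ, ((Finset.univ.filter fun i => v ∉ B i).card : ℝ) * (2 * M)
      ≤ Fintype.card ι)
    {f : (V → Fin q) → ℝ} {a : ℝ} (ha : 0 ≤ a)
    (h : ∀ X Y, (∀ v, v ∉ Λ → X v = Y v) → |f X - f Y| ≤ a * hammingDist ρ X Y) (t : ℕ) :
    ∀ X Y, (∀ v, v ∉ Λ → X v = Y v) →
      |(((Fintype.card ι : ℝ)⁻¹ • ∑ i, S.blockKernel (B i)) ^ t).mulVec f X -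
        (((Fintype.card ι : ℝ)⁻¹ • ∑ i, S.blockKernel (B i)) ^ t).mulVec f Y|
        ≤ (1 / 2) ^ t * a * hammingDist ρ X Y := by
  induction t with
  | zero => simpa using h
  | succ t ih =>
    intro X Y hXY
    rw [pow_succ', ← Matrix.mulVec_mulVec]
    set g := (((Fintype.card ι : ℝ)⁻¹ • ∑ i, S.blockKernel (B i)) ^ t).mulVec f
    set b : ℝ := (1 / 2) ^ t * a with hb
    have hb0 : 0 ≤ b := by positivity
    have hc : (0 : ℝ) < Fintype.card ι := by exact_mod_cast Fintype.card_pos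
    refine abs_sub_le_hammingDist (fun v hv X Y hXY => ?_) hXY
    by_cases hne : X v = Y v
    · have : X = Y := funext fun u => by
        by_cases hu : u = v
        · rw [hu, hne]
        · exact hXY u hu
      rw [this, sub_self, abs_zero]
      positivity
    rw [average_mulVec, average_mulVec, ← mul_sub, ← Finset.sum_sub_distrib, abs_mul,
      abs_of_pos (inv_pos.2 hc), inv_mul_le_iff₀ hc]
    calc |∑ i, ((S.blockKernel (B i)).mulVec g X - (S.blockKernel (B i)).mulVec g Y)|
        ≤ ∑ i, if v ∉ B i then b * (M * ((ρ v : ℕ) : ℝ)) else 0 :=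
          (Finset.abs_sum_le_sum_abs _ _).trans (Finset.sum_le_sum fun i _ =>
            abs_blockKernel_sub_le hCI (hB i) hb0 ih hv hne hXY)
      _ = (((Finset.univ.filter fun i => v ∉ B i).card : ℝ) * (2 * M))
            * (b * ((ρ v : ℕ) : ℝ) / 2) := by
          rw [← Finset.sum_filter, Finset.sum_const, nsmul_eq_mul]
          ring
      -- A fraction at most `1 / (2 M)` of the blocks miss `v`, and each of these expands the
      -- distance by at most `M`.
      _ ≤ Fintype.card ι * (b * ((ρ v : ℕ) : ℝ) / 2) :=
          mul_le_mul_of_nonneg_right (hmiss v hv) (by positivity)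
      _ = _ := by rw [hb, pow_succ]; ring

theorem near_block_dynamics_pow [Nonempty V] {S : SpinSystem G q} (hS : S.WellDefined) {M : ℝ}
    {ρ : V → ℕ+} (hCI : S.CouplingIndependent M ρ) {W : ℝ}
    (hW : ∀ u, ∑ v, ((ρ v : ℕ) : ℝ) ≤ W * ((ρ u : ℕ) : ℝ)) {ι : Type*} [Fintype ι] [Nonempty ι]
    {Λ : Finset V} {B : ι → Finset V} (hB : ∀ i, B i ⊆ Λ)
    (hmiss : ∀ v ∈ Λ, ((Finset.univ.filter fun i => v ∉ B i).card : ℝ) * (2 * M)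
      ≤ Fintype.card ι) (t : ℕ) :
    S.Near (((Fintype.card ι : ℝ)⁻¹ • ∑ i, S.blockKernel (B i)) ^ t) (S.blockKernel Λ)
      ((1 / 2) ^ t * W) := by
  intro X _ f hf
  set A := (Fintype.card ι : ℝ)⁻¹ • ∑ i, S.blockKernel (B i) with hA
  have hc : (0 : ℝ) < Fintype.card ι := by exact_mod_cast Fintype.card_pos
  have hρ : ∀ v, (0 : ℝ) < ((ρ v : ℕ) : ℝ) := fun v => by exact_mod_cast (ρ v).pos
  set R := ∑ v, ((ρ v : ℕ) : ℝ)
  have hRpos : 0 < R := Finset.sum_pos (fun v _ => hρ v) Finset.univ_nonempty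
  have hW0 : 0 < W := by
    obtain ⟨u⟩ := ‹Nonempty V›
    exact pos_of_mul_pos_left (hRpos.trans_le (hW u)) (hρ u).le
  have hstat : S.blockKernel Λ * A = S.blockKernel Λ := by
    rw [hA, Matrix.mul_smul, Finset.mul_sum]
    simp only [fun i => blockKernel_mul_of_subset hS (hB i), Finset.sum_const, Finset.card_univ,
      ← Nat.cast_smul_eq_nsmul ℝ, smul_smul]
    rw [inv_mul_cancel₀ hc.ne', one_smul]
  have hstat' : S.blockKernel Λ * A ^ t = S.blockKernel Λ := by
    induction t with
    | zero => simp
    | succ t ih => rw [pow_succ, ← mul_assoc, ih, hstat]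
  -- Every weight is at least `R / W`, so one disagreement already allows for the full oscillation
  -- of `f`, at most one.
  have hlip : ∀ X Y, (∀ v, v ∉ Λ → X v = Y v) → |f X - f Y| ≤ W / R * hammingDist ρ X Y := by
    refine fun X Y hXY => abs_sub_le_hammingDist (fun v _ X Y _ => ?_) hXY
    have h1 := hf X
    have h2 := hf Y
    refine le_trans (b := 1) (abs_le.2 ⟨?_, ?_⟩) ?_
    · linarith [h1.1, h2.2]
    · linarith [h1.2, h2.1]
    · rw [div_mul_eq_mul_div, le_div_iff₀ hRpos, one_mul]
      exact hW v
  have := block_dynamics_lipschitz hCI hB hmiss (by positivity) hlip t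
  -- By stationarity the block mean of `f` is the block mean of `A ^ t f`, whose oscillation over
  -- states agreeing off `Λ` is now small.
  rw [← hstat', ← Matrix.mulVec_mulVec, abs_sub_comm]
  refine abs_mulVec_sub_le (blockKernel_mem_rowStochastic hS Λ) fun Y hY => ?_
  refine (this Y X (S.agree_of_blockKernel_ne_zero hY)).trans ?_
  have hH : hammingDist ρ Y X ≤ R :=
    Finset.sum_le_sum_of_subset_of_nonneg (Finset.filter_subset _ _) fun v _ _ => (hρ v).le
  calc (1 / 2) ^ t * (W / R) * hammingDist ρ Y X ≤ (1 / 2) ^ t * (W / R) * R :=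
        mul_le_mul_of_nonneg_left hH (by positivity)
    _ = (1 / 2) ^ t * W := by field_simp

/-! ### Propagation of errors -/

theorem Near.trans {S : SpinSystem G q} {A B C : Matrix (V → Fin q) (V → Fin q) ℝ} {δ₁ δ₂ : ℝ}
    (h₁ : S.Near A B δ₁) (h₂ : S.Near B C δ₂) : S.Near A C (δ₁ + δ₂) := fun X hX f hf =>
  (abs_sub_le _ _ _).trans (add_le_add (h₁ X hX f hf) (h₂ X hX f hf))

theorem Near.average {S : SpinSystem G q} {ι : Type*} [Fintype ι] [Nonempty ι]
    {A B : ι → Matrix (V → Fin q) (V → Fin q) ℝ} {δ : ℝ} (h : ∀ i, S.Near (A i) (B i) δ) :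
    S.Near ((Fintype.card ι : ℝ)⁻¹ • ∑ i, A i) ((Fintype.card ι : ℝ)⁻¹ • ∑ i, B i) δ := by
  intro X hX f hf
  have hc : (0 : ℝ) < Fintype.card ι := by exact_mod_cast Fintype.card_pos
  rw [average_mulVec, average_mulVec, ← mul_sub, ← Finset.sum_sub_distrib, abs_mul,
    abs_of_pos (inv_pos.2 hc), inv_mul_le_iff₀ hc]
  refine ((Finset.abs_sum_le_sum_abs _ _).trans
    (Finset.sum_le_sum fun i _ => h i X hX f hf)).trans ?_
  rw [Finset.sum_const, nsmul_eq_mul, Finset.card_univ]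

/-- Telescoping through `A (A ^ t - B ^ t) + (A - B) B ^ t`. Since `A` preserves the support of `μ`,
the inductive bound may be averaged over its moves. -/
theorem Near.pow {S : SpinSystem G q} {ord : V → LinearOrder (Fin q)} {m : ℕ}
    {A B : Matrix (V → Fin q) (V → Fin q) ℝ} {δ : ℝ} (hA : S.Censored ord m A)
    (hB : B ∈ Matrix.rowStochastic ℝ (V → Fin q)) (h : S.Near A B δ) (t : ℕ) :
    S.Near (A ^ t) (B ^ t) (t * δ) := by
  induction t with
  | zero => intro X _ f _; simp
  | succ t ih =>
    intro X hX f hf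
    rw [pow_succ', pow_succ', ← Matrix.mulVec_mulVec, ← Matrix.mulVec_mulVec]
    have h1 := h X hX _ (mulVec_mem_Icc (pow_mem hB t) hf)
    have h2 := abs_mulVec_sub_le hA.stochastic (X := X) (c := 0) (a := t * δ)
      (f := (A ^ t).mulVec f - (B ^ t).mulVec f) fun Y hY => by
        rw [sub_zero]
        exact ih Y (hA.support X Y hX hY) f hf
    rw [sub_zero, Matrix.mulVec_sub, Pi.sub_apply] at h2
    push_cast
    linarith [abs_sub_le (A.mulVec ((A ^ t).mulVec f) X) (A.mulVec ((B ^ t).mulVec f) X)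
      (B.mulVec ((B ^ t).mulVec f) X)]

end SpinSystem

/-! ### Random sparse blocks -/

section Sparse

variable {V : Type*} [Fintype V] [DecidableEq V]

theorem sum_pi_prod_eq {k : ℕ} (g : V → Fin (k + 1) → ℝ) :
    ∑ f : V → Fin (k + 1), ∏ u, g u (f u) = ∏ u, ∑ c, g u c := by
  rw [Finset.prod_univ_sum, Fintype.piFinset_univ]

theorem card_filter_apply_eq_zero (k : ℕ) (v : V) :
    ((Finset.univ.filter fun f : V → Fin (k + 1) => f v = 0).card : ℝ) * ((k : ℝ) + 1)
      = ((k : ℝ) + 1) ^ Fintype.card V := by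
  have h1 : ((Finset.univ.filter fun f : V → Fin (k + 1) => f v = 0).card : ℝ)
      = ∏ u, ∑ c : Fin (k + 1), (if u = v then (if c = 0 then 1 else 0) else 1 : ℝ) := by
    rw [← sum_pi_prod_eq, Finset.card_filter]
    push_cast
    refine Finset.sum_congr rfl fun f _ => ?_
    rw [Finset.prod_ite_eq' Finset.univ v fun u => if f u = 0 then (1 : ℝ) else 0]
    simp
  have h2 : ∀ u, ∑ c : Fin (k + 1), (if u = v then (if c = 0 then 1 else 0) else 1 : ℝ)
      = if u = v then 1 else (k : ℝ) + 1 := by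
    intro u
    split_ifs <;> simp
  simp only [h2] at h1
  rw [h1, ← Finset.mul_prod_erase _ _ (Finset.mem_univ v), if_pos rfl, one_mul,
    Finset.prod_congr rfl fun u hu => if_neg (Finset.ne_of_mem_erase hu), Finset.prod_const,
    Finset.card_erase_of_mem (Finset.mem_univ v), Finset.card_univ, ← pow_succ]
  congr 1
  have : 0 < Fintype.card V := Fintype.card_pos_iff.2 ⟨v⟩
  omega

/-- The exponential moment for the Chernoff bound: colours are independent, and each vertex of `T`
contributes the mean `(1 + 2 k) / (k + 1)`. -/
theorem sum_two_pow_card_filter (k : ℕ) (T : Finset V) :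
    ∑ f : V → Fin (k + 1), (2 : ℝ) ^ (T.filter fun u => f u ≠ 0).card
      = ((k : ℝ) + 1) ^ Fintype.card V * (2 - 1 / ((k : ℝ) + 1)) ^ T.card := by
  have hk : (0 : ℝ) < (k : ℝ) + 1 := by positivity
  have h1 : ∀ f : V → Fin (k + 1), (2 : ℝ) ^ (T.filter fun u => f u ≠ 0).card
      = ∏ u, if u ∈ T then (if f u ≠ 0 then 2 else 1) else 1 := by
    intro f
    rw [Finset.prod_ite_mem, Finset.univ_inter, ← Finset.prod_filter, Finset.prod_const]
  have h2 : ∀ u, ∑ c : Fin (k + 1), (if u ∈ T then (if c ≠ 0 then 2 else 1) else 1 : ℝ)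
      = ((k : ℝ) + 1) * if u ∈ T then 2 - 1 / ((k : ℝ) + 1) else 1 := by
    intro u
    split_ifs with hu
    · rw [Fin.sum_univ_succ]
      simp
      field_simp
      ring
    · simp
  simp only [h1]
  rw [sum_pi_prod_eq fun u c => if u ∈ T then (if c ≠ 0 then (2 : ℝ) else 1) else 1]
  simp only [h2]
  rw [Finset.prod_mul_distrib, Finset.prod_const, Finset.card_univ, Finset.prod_ite_mem,
    Finset.univ_inter, Finset.prod_const]

/-- Chernoff bound: a uniformly random colouring rarely leaves too few elements of a set `T` of
at most `D` elements with colour `0`. -/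
theorem card_filter_lt_card_le (k : ℕ) (T : Finset V) {D : ℝ} (hT : (T.card : ℝ) ≤ D)
    (hD : 7 * ((k : ℝ) + 1) ^ 2 ≤ D) :
    ((Finset.univ.filter fun f : V → Fin (k + 1) =>
      (1 - 1 / (2 * ((k : ℝ) + 1))) * D < ((T.filter fun u => f u ≠ 0).card : ℝ)).card : ℝ)
        * ((k : ℝ) + 1) ≤ ((k : ℝ) + 1) ^ Fintype.card V := by
  set N : ℝ := (k : ℝ) + 1 with hN
  have hN1 : 1 ≤ N := by rw [hN]; linarith [(Nat.cast_nonneg k : (0 : ℝ) ≤ k)]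
  have hN0 : 0 < N := by linarith
  set D' := (1 - 1 / (2 * N)) * D with hD'
  set s := Finset.univ.filter fun f : V → Fin (k + 1) =>
    D' < ((T.filter fun u => f u ≠ 0).card : ℝ) with hs
  have hinv : 1 / N ≤ 1 := by rw [div_le_one hN0]; exact hN1
  have hbase : (1 : ℝ) ≤ 2 - 1 / N := by linarith
  have h1 : (s.card : ℝ) * (2 : ℝ) ^ D' ≤ N ^ Fintype.card V * (2 - 1 / N) ^ D := by
    calc (s.card : ℝ) * (2 : ℝ) ^ D' = ∑ f ∈ s, (2 : ℝ) ^ D' := by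
          rw [Finset.sum_const, nsmul_eq_mul]
      _ ≤ ∑ f ∈ s, (2 : ℝ) ^ (T.filter fun u => f u ≠ 0).card := by
          refine Finset.sum_le_sum fun f hf => ?_
          rw [← Real.rpow_natCast]
          exact Real.rpow_le_rpow_of_exponent_le (by norm_num) (Finset.mem_filter.1 hf).2.le
      _ ≤ ∑ f : V → Fin (k + 1), (2 : ℝ) ^ (T.filter fun u => f u ≠ 0).card :=
          Finset.sum_le_sum_of_subset_of_nonneg (Finset.subset_univ _) fun _ _ _ => by positivity
      _ = N ^ Fintype.card V * (2 - 1 / N) ^ T.card := sum_two_pow_card_filter k T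
      _ ≤ N ^ Fintype.card V * (2 - 1 / N) ^ D := by
          refine mul_le_mul_of_nonneg_left ?_ (by positivity)
          rw [← Real.rpow_natCast]
          exact Real.rpow_le_rpow_of_exponent_le hbase hT
  have h2 : N * (2 - 1 / N) ^ D ≤ (2 : ℝ) ^ D' := by
    have hlog : Real.log (2 - 1 / N) ≤ Real.log 2 - 1 / (2 * N) := by
      have e : 2 - 1 / N = 2 * (1 - 1 / (2 * N)) := by field_simp
      have hp : 0 < 1 - 1 / (2 * N) := by
        have : 1 / (2 * N) < 1 := by rw [div_lt_one (by positivity)]; linarith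
        linarith
      rw [e, Real.log_mul (by norm_num) hp.ne']
      linarith [Real.log_le_sub_one_of_pos hp]
    have hlogN : Real.log N ≤ N := by linarith [Real.log_le_sub_one_of_pos hN0]
    have hD0 : 0 ≤ D := le_trans (by positivity) hD
    rw [← Real.log_le_log_iff (by positivity) (by positivity),
      Real.log_mul hN0.ne' (by positivity), Real.log_rpow (by linarith),
      Real.log_rpow (by norm_num)]
    have h3 : D * Real.log (2 - 1 / N) ≤ D * (Real.log 2 - 1 / (2 * N)) :=
      mul_le_mul_of_nonneg_left hlog hD0
    -- The gain in the exponent must pay for the factor `N`, via `log N ≤ N`. This fixes the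
    -- constant 7, since `(7 / 2) (1 - log 2) > 1`.
    have h4 : N ≤ D * (1 / (2 * N)) * (1 - Real.log 2) := by
      have : 7 * N / 2 ≤ D * (1 / (2 * N)) := by
        rw [mul_one_div, le_div_iff₀ (by positivity)]
        nlinarith
      nlinarith [Real.log_two_lt_d9]
    have h5 : D' * Real.log 2 = D * Real.log 2 - D * (1 / (2 * N)) * Real.log 2 := by
      rw [hD']; ring
    linarith
  have h6 : (0 : ℝ) < (2 : ℝ) ^ D' := by positivity
  refine le_of_mul_le_mul_right ?_ h6
  calc (s.card : ℝ) * N * (2 : ℝ) ^ D' = s.card * (2 : ℝ) ^ D' * N := by ring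
    _ ≤ N ^ Fintype.card V * (2 - 1 / N) ^ D * N := mul_le_mul_of_nonneg_right h1 hN0.le
    _ = N ^ Fintype.card V * (N * (2 - 1 / N) ^ D) := by ring
    _ ≤ N ^ Fintype.card V * (2 : ℝ) ^ D' := mul_le_mul_of_nonneg_left h2 (by positivity)

variable (G : SimpleGraph V) [DecidableRel G.Adj]

/-- If all degrees in `G[Λ]` are at most `D`, there is a random subset of `Λ` in which all degrees
are at most `(1 - 1 / (2 (k + 1))) D` and which misses any vertex of `Λ` with probability at most
`2 / (k + 1)`. -/
theorem exists_sparse_blocks (k : ℕ) (Λ : Finset V) {D : ℝ}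
    (hΛ : ∀ v ∈ Λ, ((Λ.filter fun u => G.Adj v u).card : ℝ) ≤ D)
    (hD : 7 * ((k : ℝ) + 1) ^ 2 ≤ D) :
    ∃ B : (V → Fin (k + 1)) → Finset V, (∀ f, B f ⊆ Λ) ∧
      (∀ f, ∀ v ∈ B f, (((B f).filter fun u => G.Adj v u).card : ℝ)
        ≤ (1 - 1 / (2 * ((k : ℝ) + 1))) * D) ∧
      ∀ v ∈ Λ, ((Finset.univ.filter fun f => v ∉ B f).card : ℝ) * ((k : ℝ) + 1)
        ≤ 2 * Fintype.card (V → Fin (k + 1)) := by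
  -- Keep the vertices of nonzero colour with few neighbours of nonzero colour in `Λ`. Vertices
  -- removed by the second condition only lower the degrees further.
  refine ⟨fun f => Λ.filter fun v => f v ≠ 0 ∧
    (((Λ.filter fun u => G.Adj v u).filter fun u => f u ≠ 0).card : ℝ)
      ≤ (1 - 1 / (2 * ((k : ℝ) + 1))) * D, fun f => Finset.filter_subset _ _, ?_, ?_⟩
  · intro f v hv
    refine le_trans ?_ (Finset.mem_filter.1 hv).2.2
    rw [Nat.cast_le]
    refine Finset.card_le_card fun u hu => ?_
    simp only [Finset.mem_filter] at hu ⊢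
    exact ⟨⟨hu.1.1, hu.2⟩, hu.1.2.1⟩
  · intro v hv
    have hk : (0 : ℝ) ≤ (k : ℝ) + 1 := by positivity
    -- A vertex is missed because of its own colour or because of its neighbours; each has
    -- probability at most `1 / (k + 1)`.
    have hsub : (Finset.univ.filter fun f : V → Fin (k + 1) => v ∉ Λ.filter fun v => f v ≠ 0 ∧
        (((Λ.filter fun u => G.Adj v u).filter fun u => f u ≠ 0).card : ℝ)
          ≤ (1 - 1 / (2 * ((k : ℝ) + 1))) * D)
        ⊆ (Finset.univ.filter fun f : V → Fin (k + 1) => f v = 0) ∪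
          Finset.univ.filter fun f : V → Fin (k + 1) => (1 - 1 / (2 * ((k : ℝ) + 1))) * D
            < (((Λ.filter fun u => G.Adj v u).filter fun u => f u ≠ 0).card : ℝ) := by
      intro f hf
      simp only [Finset.mem_filter, Finset.mem_union, Finset.mem_univ, true_and, hv,
        not_and] at hf ⊢
      by_cases h0 : f v = 0
      · exact Or.inl h0
      · exact Or.inr (not_le.1 (hf h0))
    have hcard := (Finset.card_le_card hsub).trans (Finset.card_union_le _ _)
    have hcard' := mul_le_mul_of_nonneg_right (Nat.cast_le (α := ℝ).2 hcard) hk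
    refine hcard'.trans ?_
    push_cast
    rw [add_mul]
    have h1 := card_filter_apply_eq_zero k v
    have h2 := card_filter_lt_card_le k _ (hΛ v hv) hD
    have h3 : (Fintype.card (V → Fin (k + 1)) : ℝ) = ((k : ℝ) + 1) ^ Fintype.card V := by
      rw [Fintype.card_fun, Fintype.card_fin]; push_cast; rfl
    rw [Fintype.card_fun, Fintype.card_fin] at *
    push_cast at *
    linarith

end Sparse

theorem maxDegree_induce_le {V : Type*} (G : SimpleGraph V) [DecidableRel G.Adj]
    (Λ : Finset V) {D : ℝ} (hD : 0 ≤ D)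
    (hΛ : ∀ v ∈ Λ, ((Λ.filter fun u => G.Adj v u).card : ℝ) ≤ D) :
    ((G.induce (Λ : Set V)).maxDegree : ℝ) ≤ D := by
  refine le_trans ?_ (Nat.floor_le hD)
  rw [Nat.cast_le]
  refine SimpleGraph.maxDegree_le_of_forall_degree_le _ _ fun v => ?_
  refine Nat.le_floor (le_trans ?_ (hΛ v v.2))
  rw [Nat.cast_le, ← SimpleGraph.card_neighborFinset_eq_degree]
  refine Finset.card_le_card_of_injOn (fun u => (u : V)) (fun u hu => ?_)
    Subtype.val_injective.injOn
  simp only [Finset.mem_coe, SimpleGraph.mem_neighborFinset, SimpleGraph.comap_adj] at hu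
  exact Finset.mem_coe.2 (Finset.mem_filter.2 ⟨u.2, hu⟩)

namespace SpinSystem

variable {V : Type*} [Fintype V] [DecidableEq V] {G : SimpleGraph V} [DecidableRel G.Adj] {q : ℕ}

/-! ### Recursive implementation of block updates by censored Glauber dynamics -/

theorem mixTime_le_pinnedMixTime (S : SpinSystem G q) {η : ℝ} {Λ : Finset V}
    (hΛ : ((G.induce (Λ : Set V)).maxDegree : ℝ) ≤ η * (G.maxDegree : ℝ)) (τ : V → Fin q) :
    mixTime (S.pinnedGibbs Λ τ) (1 / (4 * Real.exp 1)) ≤ S.pinnedMixTime η :=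
  le_iSup_of_le Λ (le_iSup_of_le hΛ
    (le_iSup (fun τ => mixTime (S.pinnedGibbs Λ τ) (1 / (4 * Real.exp 1))) τ))

/-- Induction on the level. A level makes `t` rounds of block dynamics on sparser blocks, each
simulated at the level below, so the number of steps is multiplied by `t` and the error `e` becomes
`t e + (1 / 2) ^ t W`. The subtracted term in the error bound lets this recursion close for `t ≥ 2`.
-/
theorem exists_censored_near [Nonempty V] {S : SpinSystem G q} (hS : S.WellDefined)
    {ord : V → LinearOrder (Fin q)} (hm : S.IsMonotone ord) {M : ℝ} {ρ : V → ℕ+}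
    (hCI : S.CouplingIndependent M ρ) {W : ℝ} (hW0 : 0 ≤ W)
    (hW : ∀ u, ∑ v, ((ρ v : ℕ) : ℝ) ≤ W * ((ρ u : ℕ) : ℝ)) {k : ℕ} (hk : 4 * M ≤ (k : ℝ) + 1)
    {η : ℝ} (hη : 7 * ((k : ℝ) + 1) ^ 2 ≤ η * G.maxDegree) {T : ℕ} (hT : S.pinnedMixTime η ≤ T)
    {t : ℕ} (ht : 2 ≤ t) (l : ℕ) (Λ : Finset V)
    (hΛ : ∀ v ∈ Λ, ((Λ.filter fun u => G.Adj v u).card : ℝ)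
      ≤ η * G.maxDegree / (1 - 1 / (2 * ((k : ℝ) + 1))) ^ l) :
    ∃ Q, S.Censored ord (t ^ l * (t * T)) Q ∧ S.Near Q (S.blockKernel Λ)
      ((t : ℝ) ^ l * ((1 / 2) ^ t * (1 + W)) - (1 / 2) ^ t * W) := by
  have hk0 : (1 : ℝ) ≤ (k : ℝ) + 1 := by linarith [(Nat.cast_nonneg k : (0 : ℝ) ≤ k)]
  have hD0 : 0 ≤ η * G.maxDegree := le_trans (by positivity) hη
  set c : ℝ := 1 - 1 / (2 * ((k : ℝ) + 1)) with hc
  have hc0 : 0 < c := by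
    have : 1 / (2 * ((k : ℝ) + 1)) < 1 := by rw [div_lt_one (by positivity)]; linarith
    rw [hc]; linarith
  have hc1 : c ≤ 1 := by
    have : 0 ≤ 1 / (2 * ((k : ℝ) + 1)) := by positivity
    rw [hc]; linarith
  induction l generalizing Λ with
  | zero =>
    refine ⟨S.glauberOn Λ ^ (t * T), ?_, ?_⟩
    · simpa using (censored_glauberOn hS hm Λ).pow hm (t * T)
    · have := near_glauberOn_pow hS (fun τ => (S.mixTime_le_pinnedMixTime
        (maxDegree_induce_le G Λ hD0 (by simpa using hΛ)) τ).trans hT) t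
      convert this using 1
      ring
  | succ l ih =>
    have hle : η * G.maxDegree ≤ η * G.maxDegree / c ^ (l + 1) := by
      rw [le_div_iff₀ (by positivity)]
      exact mul_le_of_le_one_right hD0 (pow_le_one₀ hc0.le hc1)
    obtain ⟨B, hBΛ, hBdeg, hBmiss⟩ := exists_sparse_blocks G k Λ hΛ (hη.trans hle)
    have hcD : c * (η * G.maxDegree / c ^ (l + 1)) = η * G.maxDegree / c ^ l := by
      rw [pow_succ]; field_simp
    choose Q hQ hnear using fun f => ih (B f) fun v hv => (hBdeg f v hv).trans_eq hcD
    have hmiss : ∀ v ∈ Λ, ((Finset.univ.filter fun f => v ∉ B f).card : ℝ) * (2 * M)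
        ≤ Fintype.card (V → Fin (k + 1)) := by
      intro v hv
      have h1 := hBmiss v hv
      have h2 : ((Finset.univ.filter fun f => v ∉ B f).card : ℝ) * (4 * M)
          ≤ ((Finset.univ.filter fun f => v ∉ B f).card : ℝ) * ((k : ℝ) + 1) :=
        mul_le_mul_of_nonneg_left hk (Nat.cast_nonneg _)
      linarith
    -- All blocks are simulated with the same number of steps, so their average is again a censored
    -- dynamics of that length.
    have hQavg := Censored.average hQ
    refine ⟨_, (by rw [pow_succ, mul_comm (t ^ l) t, mul_assoc]; exact hQavg.pow hm t), ?_⟩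
    have h1 := (Near.average hnear).pow hQavg
      (average_mem_rowStochastic fun f => blockKernel_mem_rowStochastic hS (B f)) t
    have h2 := h1.trans (near_block_dynamics_pow hS hCI hW hBΛ hmiss t)
    refine fun X hX f hf => (h2 X hX f hf).trans ?_
    have hw : 0 ≤ (1 / 2 : ℝ) ^ t * W := by positivity
    have ht' : (2 : ℝ) ≤ t := by exact_mod_cast ht
    rw [pow_succ]
    nlinarith

/-- The mixing time from the maximum configuration in terms of the parameters of the recursion. -/
theorem mixTimeFrom_le_mul_pinnedMixTime [Nonempty V] {S : SpinSystem G q} (hS : S.WellDefined)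
    {ord : V → LinearOrder (Fin q)} (hm : S.IsMonotone ord) {M : ℝ} {ρ : V → ℕ+}
    (hCI : S.CouplingIndependent M ρ) {W : ℝ} (hW0 : 0 ≤ W)
    (hW : ∀ u, ∑ v, ((ρ v : ℕ) : ℝ) ≤ W * ((ρ u : ℕ) : ℝ)) {k : ℕ} (hk : 4 * M ≤ (k : ℝ) + 1)
    {η : ℝ} (hη : 7 * ((k : ℝ) + 1) ^ 2 ≤ η * G.maxDegree) {X : V → Fin q}
    (hX : S.IsMaxConfig ord X) {t l : ℕ} (ht : 2 ≤ t)
    (hl : (1 - 1 / (2 * ((k : ℝ) + 1))) ^ l ≤ η) {ε : ℝ}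
    (hε : (t : ℝ) ^ l * ((1 / 2) ^ t * (1 + W)) ≤ ε) :
    mixTimeFrom S.gibbs ε X ≤ (t ^ (l + 1) : ℕ) * S.pinnedMixTime η := by
  have hk0 : (1 : ℝ) ≤ (k : ℝ) + 1 := by linarith [(Nat.cast_nonneg k : (0 : ℝ) ≤ k)]
  have hD0 : 0 ≤ η * G.maxDegree := le_trans (by positivity) hη
  have hc0 : 0 < 1 - 1 / (2 * ((k : ℝ) + 1)) := by
    have : 1 / (2 * ((k : ℝ) + 1)) < 1 := by rw [div_lt_one (by positivity)]; linarith
    linarith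
  -- Mixing times are positive by definition, already for `Λ = ∅`. This makes the final number of
  -- steps positive and the product infinite when `pinnedMixTime` is.
  have hpos : 1 ≤ S.pinnedMixTime η := by
    have h1 : mixTime (S.pinnedGibbs ∅ X) (1 / (4 * Real.exp 1)) ≤ S.pinnedMixTime η :=
      S.mixTime_le_pinnedMixTime (maxDegree_induce_le G ∅ hD0 (by simp)) X
    refine le_trans ?_ h1
    refine le_iSup₂_of_le X (pinnedGibbs_self_pos hS ∅ hX.1) (le_iInf₂ fun s hs => ?_)
    exact_mod_cast hs.1
  by_cases htop : S.pinnedMixTime η = ⊤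
  · rw [htop, ENat.mul_top]
    · exact le_top
    · have : 0 < t ^ (l + 1) := by positivity
      exact_mod_cast this.ne'
  obtain ⟨T, hT⟩ := ENat.ne_top_iff_exists.1 htop
  obtain ⟨Q, hQ, hnear⟩ := exists_censored_near hS hm hCI hW0 hW hk hη hT.symm.le ht l
    Finset.univ fun v _ => by
      have h1 : (Finset.univ.filter fun u => G.Adj v u).card ≤ G.maxDegree := by
        rw [← SimpleGraph.neighborFinset_eq_filter]
        exact G.degree_le_maxDegree v
      refine (Nat.cast_le (α := ℝ).2 h1).trans ?_
      rw [le_div_iff₀ (by positivity), mul_comm]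
      exact mul_le_mul_of_nonneg_right hl (Nat.cast_nonneg _)
  have htv := tvDist_glauber_pow_le hS hm hX hQ hnear
  have hT1 : 0 < T := by
    rw [← hT] at hpos
    exact_mod_cast hpos
  rw [← hT, ← Nat.cast_mul]
  refine iInf₂_le_of_le (t ^ l * (t * T)) ⟨by positivity, htv.trans ?_⟩ ?_
  · have : 0 ≤ (1 / 2 : ℝ) ^ t * W := by positivity
    linarith
  · rw [pow_succ, mul_assoc]

end SpinSystem

/-! ### Choice of parameters -/

/-- Any number of levels `l` with `l + 1 ≤ 16 M log (1 / η) + 2` has `(l + 1) log (l + 1)` of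
order `M / η` when `2 M ≤ 1 / η`. -/
theorem mul_log_le_of_le {M y b : ℝ} (hM : 1 ≤ M) (hy : 2 * M ≤ y) (hb1 : 1 ≤ b)
    (hb : b ≤ 16 * M * Real.log y + 2) : b ≤ 16 * (M * y) ∧ b * Real.log b ≤ 64 * (M * y) := by
  have hy0 : 0 < y := by linarith
  set u := Real.log y with hu
  have hyu : Real.exp u = y := Real.exp_log hy0
  have hu0 : 0 ≤ u := Real.log_nonneg (by linarith)
  have hq := Real.quadratic_le_exp_of_nonneg hu0
  rw [hyu] at hq
  have hbM : b ≤ (16 * u + 2) * M := by nlinarith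
  have h1 : b ≤ 10 * (y * y) := by nlinarith [mul_nonneg hu0 hy0.le]
  have hlog : Real.log b ≤ 2 * u + 3 := by
    have h2 : 10 * (y * y) ≤ Real.exp (2 * u + 3) := by
      rw [Real.exp_add, two_mul, Real.exp_add, hyu]
      have : (10 : ℝ) ≤ Real.exp 3 := by
        have := Real.quadratic_le_exp_of_nonneg (x := 3 / 2) (by norm_num)
        have e : Real.exp 3 = Real.exp (3 / 2) * Real.exp (3 / 2) := by
          rw [← Real.exp_add]; norm_num
        rw [e]; nlinarith
      nlinarith [mul_pos hy0 hy0]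
    calc Real.log b ≤ Real.log (Real.exp (2 * u + 3)) :=
          Real.log_le_log (by linarith) (h1.trans h2)
      _ = _ := Real.log_exp _
  refine ⟨?_, ?_⟩
  · nlinarith [mul_le_mul_of_nonneg_left hq (by linarith : (0 : ℝ) ≤ M), mul_nonneg hu0 hu0]
  · calc b * Real.log b ≤ (16 * u + 2) * M * (2 * u + 3) :=
          mul_le_mul hbM hlog (Real.log_nonneg hb1) (by positivity)
      _ = M * ((16 * u + 2) * (2 * u + 3)) := by ring
      -- The product is `32 u² + 52 u + 6`, and `64 y ≥ 64 + 64 u + 32 u²` by `hq`.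
      _ ≤ M * (64 * y) := mul_le_mul_of_nonneg_left (by nlinarith) (by linarith)
      _ = _ := by ring

theorem exists_levels {M η : ℝ} {k : ℕ} (hM : 1 ≤ M) (hη : 0 < η)
    (hη' : 2 * M ≤ 1 / η) (hk : (k : ℝ) + 1 ≤ 8 * M) :
    ∃ l : ℕ, (1 - 1 / (2 * ((k : ℝ) + 1))) ^ l ≤ η ∧
      (l : ℝ) + 1 ≤ 16 * (M / η) ∧ ((l : ℝ) + 1) * Real.log ((l : ℝ) + 1) ≤ 64 * (M / η) := by
  have hlog0 : 0 ≤ Real.log (1 / η) := Real.log_nonneg (by linarith)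
  set N : ℝ := (k : ℝ) + 1 with hN
  have hN1 : 1 ≤ N := by linarith [(Nat.cast_nonneg k : (0 : ℝ) ≤ k)]
  -- Each level contributes a factor at most `exp (-1 / (2 N))`, and `N ≤ 8 M` bounds the number of
  -- levels.
  refine ⟨⌈2 * N * Real.log (1 / η)⌉₊, ?_, ?_⟩
  · set l := ⌈2 * N * Real.log (1 / η)⌉₊
    have hl : 2 * N * Real.log (1 / η) ≤ l := Nat.le_ceil _
    have h0 : 0 ≤ 1 - 1 / (2 * N) := by
      have : 1 / (2 * N) ≤ 1 := by rw [div_le_one (by positivity)]; linarith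
      linarith
    have h1 : 1 - 1 / (2 * N) ≤ Real.exp (-(1 / (2 * N))) := by
      linarith [Real.add_one_le_exp (-(1 / (2 * N)))]
    calc (1 - 1 / (2 * N)) ^ l ≤ Real.exp (-(1 / (2 * N))) ^ l := pow_le_pow_left₀ h0 h1 l
      _ = Real.exp (-(l / (2 * N))) := by rw [← Real.exp_nat_mul]; congr 1; ring
      _ ≤ Real.exp (-Real.log (1 / η)) := by
          refine Real.exp_le_exp.2 (neg_le_neg ?_)
          rw [le_div_iff₀ (by positivity)]
          linarith
      _ = η := by rw [one_div, Real.log_inv, neg_neg, Real.exp_log hη]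
  · have hl : (⌈2 * N * Real.log (1 / η)⌉₊ : ℝ) ≤ 2 * N * Real.log (1 / η) + 1 :=
      (Nat.ceil_lt_add_one (by positivity)).le
    have := mul_log_le_of_le hM hη' (b := (⌈2 * N * Real.log (1 / η)⌉₊ : ℝ) + 1)
      (by linarith [(Nat.cast_nonneg _ : (0 : ℝ) ≤ ⌈2 * N * Real.log (1 / η)⌉₊)])
      (by nlinarith)
    rwa [mul_one_div] at this

/-- `t` rounds at each of `l` levels suffice when `t` is large compared with `l²` and with the
logarithm of the target accuracy. -/
theorem pow_mul_half_pow_le {t l : ℕ} {Y ε : ℝ} (ht0 : 0 < t) (hY : 0 < Y) (hε : 0 < ε)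
    (ht : 64 * (l : ℝ) ^ 2 ≤ t) (htY : 3 * (Real.log Y - Real.log ε) ≤ t) :
    (t : ℝ) ^ l * ((1 / 2) ^ t * Y) ≤ ε := by
  have ht0' : (0 : ℝ) < t := by exact_mod_cast ht0
  have hlogt : (l : ℝ) * Real.log t ≤ t / 4 := by
    set s := Real.sqrt t with hs
    have hss : s * s = t := Real.mul_self_sqrt ht0'.le
    have hs0 : 0 < s := Real.sqrt_pos.2 ht0'
    have h1 : Real.log t ≤ 2 * s := by
      rw [← hss, Real.log_mul hs0.ne' hs0.ne']
      linarith [Real.log_le_sub_one_of_pos hs0]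
    have h2 : 8 * (l : ℝ) ≤ s := by
      refine Real.le_sqrt_of_sq_le ?_
      linarith
    calc (l : ℝ) * Real.log t ≤ l * (2 * s) :=
          mul_le_mul_of_nonneg_left h1 (Nat.cast_nonneg l)
      _ ≤ t / 4 := by nlinarith
  rw [← Real.log_le_log_iff (by positivity) hε, Real.log_mul (by positivity) (by positivity),
    Real.log_mul (by positivity) hY.ne', Real.log_pow, Real.log_pow, one_div, Real.log_inv]
  -- The polynomial factor costs `t / 4` and the accuracy `t / 3` in the exponent, and `1 / 4 + 1 /
  -- 3 < log 2`.
  nlinarith [Real.log_two_gt_d9]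

theorem mul_log_rounds_le {K b d ℓ x t : ℝ} (hK : 1 ≤ K) (hb : 1 ≤ b) (hd : 0 ≤ d) (hℓ : 0 < ℓ)
    (hlogℓ : 1 ≤ Real.log ℓ) (hbx : b ≤ 16 * x) (hblog : b * Real.log b ≤ 64 * x) (ht0 : 0 < t)
    (ht : t ≤ 128 * K * b ^ 2 * (d + 1) * ℓ) :
    b * Real.log t ≤ (16 * Real.log (128 * K) + 209) * (x + d) * Real.log ℓ := by
  have hb0 : 0 < b := by linarith
  have hx0 : 0 ≤ x := by linarith
  have hlogK : 0 ≤ Real.log (128 * K) := Real.log_nonneg (by linarith)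
  have hlogt : Real.log t
      ≤ Real.log (128 * K) + 2 * Real.log b + Real.log (d + 1) + Real.log ℓ := by
    refine (Real.log_le_log ht0 ht).trans (le_of_eq ?_)
    rw [Real.log_mul (by positivity) hℓ.ne', Real.log_mul (by positivity) (by positivity),
      Real.log_mul (by positivity) (by positivity), Real.log_pow]
    norm_num
  -- Comparing `d + 1` with `b` makes the bound additive in `d` and `b log b`; this is how the
  -- exponent comes to be linear in `M / η + d`.
  have hlogd : b * Real.log (d + 1) ≤ d + b * Real.log b := by
    have h1 := Real.log_le_sub_one_of_pos (by positivity : 0 < (d + 1) / b)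
    rw [Real.log_div (by positivity) hb0.ne'] at h1
    have h2 := mul_le_mul_of_nonneg_left h1 hb0.le
    have h3 : b * ((d + 1) / b - 1) = d + 1 - b := by field_simp
    rw [h3] at h2
    linarith
  have h1 := mul_le_mul_of_nonneg_left hlogt hb0.le
  have h2 : b * Real.log (128 * K) ≤ 16 * x * Real.log (128 * K) :=
    mul_le_mul_of_nonneg_right hbx hlogK
  have h3 : b * Real.log ℓ ≤ 16 * x * Real.log ℓ :=
    mul_le_mul_of_nonneg_right hbx (by linarith)
  have h4 : b * Real.log t
      ≤ (16 * Real.log (128 * K) + 192) * x + d + 16 * x * Real.log ℓ := by linarith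
  have h5 : (16 * Real.log (128 * K) + 192) * x + d
      ≤ ((16 * Real.log (128 * K) + 192) * x + d) * Real.log ℓ :=
    le_mul_of_one_le_right (by positivity) hlogℓ
  have h6 : (16 * Real.log (128 * K) + 208) * x + d
      ≤ (16 * Real.log (128 * K) + 209) * (x + d) := by
    linarith [mul_nonneg hlogK hd]
  have h7 := mul_le_mul_of_nonneg_right h6 (by linarith : 0 ≤ Real.log ℓ)
  linarith

theorem exists_parameters (K : ℝ) : ∃ C : ℝ, 0 < C ∧
    ∀ (M η d ε : ℝ) (k n : ℕ), 1 ≤ M → 0 < η → 2 * M ≤ 1 / η → 0 ≤ d → (k : ℝ) + 1 ≤ 8 * M →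
      16 ≤ n → 0 < ε → ε < 1 → 0 ≤ K * (n : ℝ) ^ d →
      ∃ l t : ℕ, 2 ≤ t ∧ (1 - 1 / (2 * ((k : ℝ) + 1))) ^ l ≤ η ∧
        (t : ℝ) ^ l * ((1 / 2) ^ t * (1 + K * (n : ℝ) ^ d * n)) ≤ ε ∧
        (t : ℝ) ^ (l + 1) ≤ Real.log (n / ε) ^ (C * (M / η + d)) := by
  -- The constant must be chosen for every real `K`, while logarithms of `K'` have to be
  -- nonnegative.
  set K' : ℝ := max K 1 with hK'
  have hK1 : 1 ≤ K' := le_max_right _ _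
  have hKK : K ≤ K' := le_max_left _ _
  have hlogK : 0 ≤ Real.log (128 * K') := Real.log_nonneg (by linarith)
  refine ⟨16 * Real.log (128 * K') + 209, by positivity, ?_⟩
  intro M η d ε k n hM hη hη' hd hk hn hε hε1 hKn
  obtain ⟨l, hl, hlx, hlogl⟩ := exists_levels hM hη hη' hk
  set x := M / η with hx
  set b : ℝ := (l : ℝ) + 1 with hb
  have hb1 : 1 ≤ b := by linarith [(Nat.cast_nonneg l : (0 : ℝ) ≤ l)]
  have hn' : (16 : ℝ) ≤ n := by exact_mod_cast hn
  have hn0 : (0 : ℝ) < n := by linarith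
  set ℓ := Real.log (n / ε) with hℓ
  have hℓeq : ℓ = Real.log n - Real.log ε := Real.log_div hn0.ne' hε.ne'
  have hlogε : Real.log ε ≤ 0 := Real.log_nonpos hε.le hε1.le
  -- The bound `n ≥ 16` serves to give `log (log (n / ε)) ≥ 1`, which absorbs additive constants
  -- into the exponent.
  have hlogn : Real.exp 1 ≤ Real.log n := by
    have h1 : Real.log 16 ≤ Real.log n := Real.log_le_log (by norm_num) hn'
    have h2 : Real.log 16 = 4 * Real.log 2 := by
      rw [show (16 : ℝ) = 2 ^ 4 by norm_num, Real.log_pow]; norm_num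
    linarith [Real.exp_one_lt_d9, Real.log_two_gt_d9]
  have hℓe : Real.exp 1 ≤ ℓ := by linarith
  have hℓ1 : 1 ≤ ℓ := by linarith [Real.add_one_le_exp (1 : ℝ)]
  have hℓ0 : 0 < ℓ := by linarith
  have hlogℓ : 1 ≤ Real.log ℓ := (Real.le_log_iff_exp_le hℓ0).2 hℓe
  -- The factor `b ^ 2` beats the polynomial loss `t ^ l`; `K'` and `(d + 1) ℓ` dominate the
  -- logarithm of the initial Lipschitz bound over `ε`.
  set r : ℝ := 64 * K' * b ^ 2 * (d + 1) * ℓ with hr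
  have hbsq : 1 ≤ b ^ 2 := one_le_pow₀ hb1
  have hdl : 1 ≤ (d + 1) * ℓ := one_le_mul_of_one_le_of_one_le (by linarith) hℓ1
  have hr1 : 64 * b ^ 2 ≤ r := by
    have : 1 ≤ K' * ((d + 1) * ℓ) := one_le_mul_of_one_le_of_one_le hK1 hdl
    calc 64 * b ^ 2 = 64 * b ^ 2 * 1 := by ring
      _ ≤ 64 * b ^ 2 * (K' * ((d + 1) * ℓ)) := mul_le_mul_of_nonneg_left this (by positivity)
      _ = r := by rw [hr]; ring
  have hr2 : 64 * K' * ((d + 1) * ℓ) ≤ r := by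
    calc 64 * K' * ((d + 1) * ℓ) = 64 * K' * ((d + 1) * ℓ) * 1 := by ring
      _ ≤ 64 * K' * ((d + 1) * ℓ) * b ^ 2 := mul_le_mul_of_nonneg_left hbsq (by positivity)
      _ = r := by rw [hr]; ring
  have hrt : r ≤ ⌈r⌉₊ := Nat.le_ceil r
  have htr : (⌈r⌉₊ : ℝ) ≤ 2 * r := by
    have := (Nat.ceil_lt_add_one (by positivity : 0 ≤ r)).le
    linarith
  have ht2 : 2 ≤ ⌈r⌉₊ := by
    have : (2 : ℝ) ≤ ⌈r⌉₊ := by linarith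
    exact_mod_cast this
  refine ⟨l, ⌈r⌉₊, ht2, hl, ?_, ?_⟩
  · refine pow_mul_half_pow_le (by omega) (by positivity) hε ?_ ?_
    · nlinarith [(Nat.cast_nonneg l : (0 : ℝ) ≤ l)]
    · have hnd : (1 : ℝ) ≤ (n : ℝ) ^ d * n :=
        one_le_mul_of_one_le_of_one_le (Real.one_le_rpow (by linarith) hd) (by linarith)
      have h1 : 1 + K * (n : ℝ) ^ d * n ≤ 2 * K' * ((n : ℝ) ^ d * n) := by
        have h2 : K * ((n : ℝ) ^ d * n) ≤ K' * ((n : ℝ) ^ d * n) :=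
          mul_le_mul_of_nonneg_right hKK (by positivity)
        have h3 : 1 ≤ K' * ((n : ℝ) ^ d * n) := one_le_mul_of_one_le_of_one_le hK1 hnd
        linarith
      have h2 : Real.log (1 + K * (n : ℝ) ^ d * n) ≤ 2 * K' + (d + 1) * Real.log n := by
        refine (Real.log_le_log (by positivity) h1).trans ?_
        rw [Real.log_mul (by positivity) (by positivity),
          Real.log_mul (by positivity) hn0.ne', Real.log_rpow hn0]
        linarith [Real.log_le_sub_one_of_pos (by positivity : 0 < 2 * K')]
      have h3 : (d + 1) * Real.log n - Real.log ε ≤ (d + 1) * ℓ := by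
        rw [hℓeq]; nlinarith
      nlinarith [mul_le_mul_of_nonneg_left hdl (by linarith : 0 ≤ K')]
  · rw [← Real.log_le_log_iff (by positivity) (by positivity), Real.log_pow, Real.log_rpow hℓ0]
    push_cast
    rw [← hb]
    exact mul_log_rounds_le hK1 hb1 hd hℓ0 hlogℓ hlx hlogl (by linarith) (htr.trans_eq (by ring))

end MixCom

end

/-! ### Assembly of the theorem -/

theorem mainTheorem5 :
    ∃ C₀ : ℝ, 0 < C₀ ∧ ∀ K : ℝ, ∃ C : ℝ, 0 < C ∧
      ∀ (M η d : ℝ), 1 ≤ M → 0 < η → η ≤ 1 / (2 * (⌈M⌉₊ : ℝ)) → 0 ≤ d →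
      ∀ (V : Type*) [Fintype V] [DecidableEq V] (G : SimpleGraph V) [DecidableRel G.Adj]
        (q : ℕ) (S : MixCom.SpinSystem G q) (ord : V → LinearOrder (Fin q))
        (ρ : V → ℕ+) (Xmax : V → Fin q) (ε : ℝ),
        2 ≤ q →
        S.WellDefined →
        S.IsMonotone ord →
        C₀ * (M ^ 2 / η ^ 2 * Real.log (M / η)) ≤ (G.maxDegree : ℝ) →
        S.CouplingIndependent M ρ →
        (∀ u v, ((ρ u : ℕ) : ℝ) / ((ρ v : ℕ) : ℝ) ≤ K * (Fintype.card V : ℝ) ^ d) →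
        S.IsMaxConfig ord Xmax →
        0 < ε → ε < 1 →
        ((MixCom.mixTimeFrom S.gibbs ε Xmax : ℕ∞) : ENNReal) ≤
          ENNReal.ofReal (Real.log ((Fintype.card V : ℝ) / ε) ^ (C * (M / η + d))) *
            ((S.pinnedMixTime η : ℕ∞) : ENNReal) := by
  -- The sparsification needs `7 (k + 1) ^ 2 ≤ η Δ`; with `k + 1 = 4 ⌈M⌉ ≤ 8 M` this follows from
  -- `448 M ^ 2 ≤ η Δ`.
  refine ⟨448, by norm_num, fun K => ?_⟩
  obtain ⟨C, hC, hpar⟩ := MixCom.exists_parameters K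
  refine ⟨C, hC, ?_⟩
  intro M η d hM hη hη2 hd V _ _ G _ q S ord ρ Xmax ε _ hS hm hΔ hCI hρ hX hε hε1
  have hceil : M ≤ (⌈M⌉₊ : ℝ) := Nat.le_ceil M
  have hceil' : (⌈M⌉₊ : ℝ) ≤ 2 * M := by linarith [Nat.ceil_lt_add_one (by linarith : 0 ≤ M)]
  have hη' : 2 * M ≤ 1 / η := by
    rw [le_div_iff₀ hη]
    rw [le_div_iff₀ (by linarith)] at hη2
    nlinarith
  have hηinv : 2 ≤ 1 / η := by linarith
  have hlog : 1 / 2 ≤ Real.log (M / η) := by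
    have h1 : (2 : ℝ) ≤ M / η := by
      rw [div_eq_mul_one_div]; nlinarith
    linarith [Real.log_two_gt_d9, Real.log_le_log (by norm_num) h1]
  have hηΔ : 448 * M ^ 2 ≤ η * G.maxDegree := by
    have h1 : M ^ 2 * (1 / η) ≤ η * (M ^ 2 / η ^ 2 * Real.log (M / η)) * 2 := by
      have e : η * (M ^ 2 / η ^ 2 * Real.log (M / η)) * 2
          = M ^ 2 * (1 / η) * (2 * Real.log (M / η)) := by field_simp
      rw [e]
      exact le_mul_of_one_le_right (by positivity) (by linarith)
    have h2 := mul_le_mul_of_nonneg_left hΔ hη.le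
    nlinarith [sq_nonneg M]
  have hη1 : η ≤ 1 := by
    rw [le_div_iff₀ hη] at hηinv
    linarith
  have hn : 16 ≤ Fintype.card V := by
    have h1 : (16 : ℝ) ≤ G.maxDegree := by
      have : η * G.maxDegree ≤ 1 * G.maxDegree :=
        mul_le_mul_of_nonneg_right hη1 (Nat.cast_nonneg _)
      nlinarith
    have h2 : 16 ≤ G.maxDegree := by exact_mod_cast h1
    by_contra hlt
    have h3 : G.maxDegree ≤ Fintype.card V :=
      G.maxDegree_le_of_forall_degree_le _ fun v => (G.degree_lt_card_verts v).le
    omega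
  have : Nonempty V := Fintype.card_pos_iff.1 (by omega)
  have hn0 : (0 : ℝ) < Fintype.card V := by exact_mod_cast (by omega : 0 < Fintype.card V)
  have hρpos : ∀ v, (0 : ℝ) < ((ρ v : ℕ) : ℝ) := fun v => by exact_mod_cast (ρ v).pos
  have hKn : 0 ≤ K * (Fintype.card V : ℝ) ^ d :=
    le_trans (by positivity) (hρ (Classical.arbitrary V) (Classical.arbitrary V))
  have hW : ∀ u, ∑ v, ((ρ v : ℕ) : ℝ)
      ≤ K * (Fintype.card V : ℝ) ^ d * Fintype.card V * ((ρ u : ℕ) : ℝ) := by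
    intro u
    calc ∑ v, ((ρ v : ℕ) : ℝ)
        ≤ ∑ _v : V, K * (Fintype.card V : ℝ) ^ d * ((ρ u : ℕ) : ℝ) :=
          Finset.sum_le_sum fun v _ => (div_le_iff₀ (hρpos u)).1 (hρ v u)
      _ = _ := by rw [Finset.sum_const, Finset.card_univ, nsmul_eq_mul]; ring
  -- At least `4 M` colours make the missing probability `2 / (k + 1)` at most `1 / (2 M)`; at most
  -- `8 M` keep the number of levels of order `M log (1 / η)`.
  obtain ⟨k, hk⟩ : ∃ k : ℕ, (k : ℝ) + 1 = 4 * ⌈M⌉₊ := by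
    have : 0 < ⌈M⌉₊ := Nat.ceil_pos.2 (by linarith)
    refine ⟨4 * ⌈M⌉₊ - 1, ?_⟩
    rw [Nat.cast_sub (by omega)]
    push_cast
    ring
  obtain ⟨l, t, ht, hl, hle, hbound⟩ := hpar M η d ε k (Fintype.card V) hM hη hη' hd
    (by linarith) hn hε hε1 hKn
  have key := MixCom.SpinSystem.mixTimeFrom_le_mul_pinnedMixTime hS hm hCI (by positivity) hW
    (by linarith : 4 * M ≤ (k : ℝ) + 1) (by nlinarith) hX ht hl hle
  calc ((MixCom.mixTimeFrom S.gibbs ε Xmax : ℕ∞) : ENNReal)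
      ≤ (((t ^ (l + 1) : ℕ) * S.pinnedMixTime η : ℕ∞) : ENNReal) := ENat.toENNReal_le.2 key
    _ = ENNReal.ofReal ((t : ℝ) ^ (l + 1)) * ((S.pinnedMixTime η : ℕ∞) : ENNReal) := by
        rw [ENat.toENNReal_mul, ENat.toENNReal_coe, ← Nat.cast_pow, ENNReal.ofReal_natCast]
    _ ≤ _ := mul_le_mul_left (ENNReal.ofReal_le_ofReal hbound) _
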